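/- Let $L\ge 1$ be a fixed integer and, for each integer $N\ge 1$, let $M=M(N)\ge 1$ be an integer such that $c_N=\frac{M(N)L}{N}\to c_*$ as $N\to+\infty$, for some $c_*>0$. Let $0<a<b$ be constants and, for each $N\geq 1$, let $R_N$ be an $M\times M$ Hermitian matrix with $aI_M\le R_N<bI_M$. Put $\mathbb C^+=\{z:\operatorname{Im}z>0\}$ and $\mathbb R^+=[0,+\infty)$. 1. For every $N\ge 1$ and $z\in\mathbb C^+$ the equation $$t=\frac1M\operatorname{Tr}\,R_N\Big(-zI_M-\frac{zc_Nt}{1-zc_N^2t^2}R_N\Big)^{-1}$$ has a unique solution $t=t_N(z)$ with $t\in\mathbb C^+$ and $zt\in\mathbb C^+$. For this solution $1-zc_N^2t_N(z)^2\neq 0$ and the matrix being inverted is invertible. 2. For every $N\ge1$, $z\mapsto t_N(z)$ is the Stieltjes transform of a positive finite measure $\mu_N$ carried by $\mathbb R^+$, that is, $t_N(z)=\int_{\mathbb R^+}\frac{d\mu_N(\lambda)}{\lambda-z}$ for $z\in\mathbb C^+$, and $$\mu_N(\mathbb R^+)=\frac1M\operatorname{Tr}R_N,\qquad \int_{\mathbb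 R^+}\lambda\,d\mu_N(\lambda)=c_N\,\frac1M\operatorname{Tr}R_N\,\frac1M\operatorname{Tr}R_N^2 .$$ 3. There are constants $\beta,\kappa>0$, independent of $N$ and $z$, such that for all $N\ge1$ and $z\in\mathbb C^+$ $$\frac1{|1-z(c_Nt_N(z))^2|}\le\frac{\kappa(\beta^2+|z|^2)^2}{(\operatorname{Im}z)^3}.$$ 4. For every $N\ge1$, the matrix-valued function $$T_N(z)=-\Big(zI_M+\frac{zc_Nt_N(z)}{1-zc_N^2t_N(z)^2}R_N\Big)^{-1}$$ is the Stieltjes transform on $\mathbb C^+$ of a positive (Hermitian positive semidefinite) $M\times M$ matrix-valued finite measure $\nu_N^T$ carried by $\mathbb R^+$, with $\nu_N^T(\mathbb R^+)=I_M$ and $\mu_N=\frac1M\operatorname{Tr}R_N\nu_N^T$. -/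

import Mathlib

open MeasureTheory Filter Topology
open scoped ComplexOrder

/-- `f` is, on the upper half-plane, the Stieltjes transform `∫ dμ(x) / (x - z)` of the positive
finite measure `μ` carried by the Borel set `A`. -/
def IsStieltjesTransform (A : Set ℝ) (μ : Measure ℝ) (f : ℂ → ℂ) : Prop :=
  IsFiniteMeasure μ ∧ μ Aᶜ = 0 ∧
    ∀ z : ℂ, 0 < z.im → f z = ∫ x : ℝ, ((x : ℂ) - z)⁻¹ ∂μ

/-- The complex measure `S ↦ (ν S) i j`, the `(i, j)` entry of a matrix-valued measure `ν`. -/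
noncomputable def entryMeasure {m : ℕ} (ν : VectorMeasure ℝ (Matrix (Fin m) (Fin m) ℂ))
    (i j : Fin m) : ComplexMeasure ℝ :=
  ν.mapRange (Matrix.entryAddMonoidHom ℂ i j) (continuous_id.matrix_elem i j)

theorem entryMeasure_apply {m : ℕ} (ν : VectorMeasure ℝ (Matrix (Fin m) (Fin m) ℂ))
    (i j : Fin m) (S : Set ℝ) : entryMeasure ν i j S = ν S i j := rfl

/-- `F` is, on the upper half-plane, the Stieltjes transform `∫ dν(x) / (x - z)` (entry by entry)
of the positive (i.e. with positive semidefinite Hermitian values) finite matrix-valued measure `ν`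
carried by the Borel set `A`. A `VectorMeasure` is σ-additive with values in matrices, so finiteness
is built in. -/
def IsMatrixStieltjesTransform {m : ℕ} (A : Set ℝ)
    (ν : VectorMeasure ℝ (Matrix (Fin m) (Fin m) ℂ))
    (F : ℂ → Matrix (Fin m) (Fin m) ℂ) : Prop :=
  (∀ S : Set ℝ, MeasurableSet S → (ν S).PosSemidef) ∧ ν Aᶜ = 0 ∧
    ∀ z : ℂ, 0 < z.im → ∀ i j : Fin m,
      F z i j =
        (entryMeasure ν i j).integral (fun x : ℝ => ((x : ℂ) - z)⁻¹) (ContinuousLinearMap.mul ℝ ℂ)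

/-- The scalar `z c t / (1 - z c² t²)`. -/
noncomputable def couplingCoeff (c : ℝ) (z t : ℂ) : ℂ :=
  z * c * t / (1 - z * (c : ℂ) ^ 2 * t ^ 2)

/-- `t` solves `t = (1/m) Tr R (-z I - (z c t / (1 - z c² t²)) R)⁻¹`, with `t` and `z t` in the
open upper half-plane. -/
def IsCanonicalSolution {m : ℕ} (c : ℝ) (R : Matrix (Fin m) (Fin m) ℂ) (z t : ℂ) : Prop :=
  t = (1 / (m : ℂ)) *
      (R * (-(z • (1 : Matrix (Fin m) (Fin m) ℂ)) - couplingCoeff c z t • R)⁻¹).trace ∧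
    0 < t.im ∧ 0 < (z * t).im

/-- The matrix `T = -(z I + (z c t / (1 - z c² t²)) R)⁻¹`. -/
noncomputable def canonicalT {m : ℕ} (c : ℝ) (R : Matrix (Fin m) (Fin m) ℂ) (z t : ℂ) :
    Matrix (Fin m) (Fin m) ℂ :=
  -(z • (1 : Matrix (Fin m) (Fin m) ℂ) + couplingCoeff c z t • R)⁻¹

/-- The ratio `c_N = M(N) L / N`. -/
noncomputable def dimRatio (L : ℕ) (M : ℕ → ℕ) (N : ℕ) : ℝ :=
  (M N : ℝ) * (L : ℝ) / (N : ℝ)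

/-!
Write `z = u ^ 2` with `Re u, Im u > 0` and `h = u t`. In an eigenbasis of `R`, with eigenvalues
`rᵢ` and weights `aᵢ = rᵢ / m`, the equation for `t` becomes the fixed-point equation
`h = Φ_u(h) = ∑ᵢ aᵢ gᵢ(h)` on the open upper half-plane, where `gᵢ(h) = -(u + rᵢ s(h))⁻¹` and
`s(h) = c h / (1 - c² h²)`. The map `s` is a composition of maps of the upper half-plane into
itself and the shift by `u` is a strict hyperbolic contraction, so `Φ_u` has at most one fixed
point and its iterates from `0` converge to it.

Every such iterate is, as a function of `u`, an odd rational function which is the Stieltjes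
transform of a finite atomic measure; folding this measure by `x ↦ x²` gives a measure on `[0, ∞)`
in the variable `z`. Bounded first moments make these measures tight, so they have limits `νᵢ`,
representing `gᵢ / u` at the fixed point. Their means are read off from the asymptotics of `gᵢ` as
`Im u → ∞`. Then `μ = ∑ᵢ aᵢ νᵢ`, and `ν` is the conjugate of `diag(νᵢ)` by the eigenvector unitary.

For the uniform bound, taking imaginary parts in the fixed-point equation gives
`Im z |t| ≤ 2 (∑ᵢ aᵢ) |1 - z (c t)²|`, while at least half of the mass of `μ` lies in a fixed
interval by Markov's inequality, so that `|t| ≥ Im t` is at least a constant times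
`Im z / (K² + |z|²)`.
-/

theorem norm_sum_weighted_mul_sq_le {ι : Type*} (s : Finset ι) {w : ι → ℝ} (hw : ∀ i ∈ s, 0 ≤ w i)
    (x y : ι → ℂ) :
    ‖∑ i ∈ s, (w i : ℂ) * (x i * y i)‖ ^ 2 ≤
      (∑ i ∈ s, w i * ‖x i‖ ^ 2) * ∑ i ∈ s, w i * ‖y i‖ ^ 2 := by
  have htriangle : ‖∑ i ∈ s, (w i : ℂ) * (x i * y i)‖ ≤ ∑ i ∈ s, w i * (‖x i‖ * ‖y i‖) := by
    refine (norm_sum_le _ _).trans (Finset.sum_le_sum fun i hi => ?_)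
    rw [norm_mul, norm_mul, Complex.norm_real, Real.norm_of_nonneg (hw i hi)]
  refine (pow_le_pow_left₀ (norm_nonneg _) htriangle 2).trans ?_
  exact Finset.sum_sq_le_sum_mul_sum_of_sq_le_mul _
    (fun i hi => mul_nonneg (hw i hi) (sq_nonneg _))
    (fun i hi => mul_nonneg (hw i hi) (sq_nonneg _)) fun i _ => le_of_eq (by ring)

theorem neg_inv_im (x : ℂ) : (-x⁻¹).im = ‖x⁻¹‖ ^ 2 * x.im := by
  rw [Complex.neg_im, Complex.inv_im, norm_inv, inv_pow, Complex.sq_norm]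
  ring

theorem ne_zero_of_im_pos {z : ℂ} (hz : 0 < z.im) : z ≠ 0 := by
  rintro rfl
  exact hz.ne rfl

/-- In `hx`, `‖x - y‖ ^ 2 / (Im x * Im y)` stands for the hyperbolic distance of `x` and `y`, of
which it is an increasing function. -/
theorem cauchySeq_of_hyperbolic_contraction {x : ℕ → ℂ} {ρ B : ℝ} (hρ₀ : 0 ≤ ρ) (hρ₁ : ρ < 1)
    (hpos : ∀ n, 0 < (x n).im) (hB : ∀ n, (x n).im ≤ B)
    (hx : ∀ n, ‖x (n + 2) - x (n + 1)‖ ^ 2 * ((x (n + 1)).im * (x n).im) ≤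
      ρ ^ 2 * ‖x (n + 1) - x n‖ ^ 2 * ((x (n + 2)).im * (x (n + 1)).im)) :
    CauchySeq x := by
  set q : ℕ → ℝ := fun n => ‖x (n + 1) - x n‖ ^ 2 / ((x (n + 1)).im * (x n).im) with hq
  have him : ∀ n, 0 < (x (n + 1)).im * (x n).im := fun n => mul_pos (hpos _) (hpos _)
  have hgeom : ∀ n, q n ≤ (ρ ^ 2) ^ n * q 0 := fun n =>
    le_geom (sq_nonneg ρ) n fun k _ => by
      rw [hq, ← mul_div_assoc, div_le_div_iff₀ (him _) (him _)]
      exact hx k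
  have hB₀ : 0 ≤ B := (hpos 0).le.trans (hB 0)
  have hq₀ : 0 ≤ q 0 := div_nonneg (sq_nonneg _) (him 0).le
  refine cauchySeq_of_le_geometric ρ (√(q 0) * B) hρ₁ fun n => ?_
  rw [dist_comm, dist_eq_norm]
  refine le_of_sq_le_sq ?_ (by positivity)
  calc ‖x (n + 1) - x n‖ ^ 2 = q n * ((x (n + 1)).im * (x n).im) := by
        rw [hq, div_mul_cancel₀ _ (him n).ne']
    _ ≤ (ρ ^ 2) ^ n * q 0 * (B * B) :=
        mul_le_mul (hgeom n) (mul_le_mul (hB _) (hB _) (hpos n).le hB₀) (him n).le (by positivity)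
    _ = (√(q 0) * B * ρ ^ n) ^ 2 := by
        rw [mul_pow, mul_pow, Real.sq_sqrt hq₀]
        ring

/-- The function `c h / (1 - c² h²)`, which maps the upper half-plane to itself. With `z = u ^ 2`
and `h = u t`, it is the coefficient `couplingCoeff c z t` divided by `u`. -/
noncomputable def selfEnergy (c : ℝ) (h : ℂ) : ℂ := c * h / (1 - (c : ℂ) ^ 2 * h ^ 2)

/-- The function `-1 / (u + r σ(h))` with `σ` the self-energy: the eigenvalue of `u T` on an
eigenvector of `R` for the eigenvalue `r`, where `T` is the matrix `canonicalT` at `z = u ^ 2`,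
`h = u t`. -/
noncomputable def dressedResolvent (c r : ℝ) (u h : ℂ) : ℂ := -(u + r * selfEnergy c h)⁻¹

/-- The map whose fixed points in the upper half-plane are the `h = u t` with `t` a solution of the
canonical equation at `z = u ^ 2`; the `r i` are the eigenvalues of `R` and `a i = r i / m`. -/
noncomputable def resolventMap {ι : Type*} [Fintype ι] (a r : ι → ℝ) (c : ℝ) (u h : ℂ) : ℂ :=
  ∑ i, (a i : ℂ) * dressedResolvent c (r i) u h

/-- The part of `Im (resolventMap a r c u h)` that comes from `Im h`, as opposed to `Im u`. -/
noncomputable def imTransfer {ι : Type*} [Fintype ι] (a r : ι → ℝ) (c : ℝ) (u h : ℂ) : ℝ :=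
  (∑ i, a i * r i * ‖dressedResolvent c (r i) u h‖ ^ 2) * (selfEnergy c h).im

section SelfEnergy

variable {c r : ℝ} {u h k : ℂ}

theorem one_sub_sq_mul_sq_ne_zero (c : ℝ) (hh : 0 < h.im) : 1 - (c : ℂ) ^ 2 * h ^ 2 ≠ 0 := by
  intro H
  have hfactor : (1 - c * h) * (1 + c * h) = 0 := by linear_combination H
  have hc : c = 0 := by
    rcases mul_eq_zero.1 hfactor with h0 | h0 <;>
      simpa [hh.ne'] using congrArg Complex.im h0
  simp [hc] at H

theorem selfEnergy_zero (c : ℝ) : selfEnergy c 0 = 0 := by simp [selfEnergy]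

theorem selfEnergy_neg (c : ℝ) (h : ℂ) : selfEnergy c (-h) = -selfEnergy c h := by
  simp [selfEnergy, neg_div]

theorem selfEnergy_im (c : ℝ) (h : ℂ) :
    (selfEnergy c h).im =
      c * (1 + c ^ 2 * ‖h‖ ^ 2) / ‖1 - (c : ℂ) ^ 2 * h ^ 2‖ ^ 2 * h.im := by
  rw [selfEnergy, Complex.div_im, Complex.sq_norm, Complex.sq_norm, Complex.normSq_apply h]
  simp only [Complex.mul_im, Complex.ofReal_re, Complex.ofReal_im, zero_mul, add_zero, pow_two,
    Complex.sub_re, Complex.one_re, Complex.mul_re, mul_zero, sub_zero, Complex.sub_im,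
    Complex.one_im, zero_sub, mul_neg]
  ring

theorem selfEnergy_im_nonneg (hc : 0 ≤ c) (hh : 0 ≤ h.im) : 0 ≤ (selfEnergy c h).im := by
  rw [selfEnergy_im]
  positivity

theorem selfEnergy_sub (c : ℝ) (hh : 0 < h.im) (hk : 0 < k.im) :
    selfEnergy c h - selfEnergy c k = (h - k) * (c * (1 + (c : ℂ) ^ 2 * (h * k)) /
      ((1 - (c : ℂ) ^ 2 * h ^ 2) * (1 - (c : ℂ) ^ 2 * k ^ 2))) := by
  have hh' := one_sub_sq_mul_sq_ne_zero c hh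
  have hk' := one_sub_sq_mul_sq_ne_zero c hk
  unfold selfEnergy
  field_simp
  ring

/-- The Schwarz–Pick inequality for the self-energy, by Cauchy–Schwarz in `ℂ²` for `(1, c h)` and
`(1, c k)`. -/
theorem norm_selfEnergy_sub_sq_mul_le (c : ℝ) (hh : 0 < h.im) (hk : 0 < k.im) :
    ‖selfEnergy c h - selfEnergy c k‖ ^ 2 * (h.im * k.im) ≤
      ‖h - k‖ ^ 2 * ((selfEnergy c h).im * (selfEnergy c k).im) := by
  have hcs : ‖1 + (c : ℂ) ^ 2 * (h * k)‖ ^ 2 ≤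
      (1 + c ^ 2 * ‖h‖ ^ 2) * (1 + c ^ 2 * ‖k‖ ^ 2) := by
    have htriangle : ‖1 + (c : ℂ) ^ 2 * (h * k)‖ ≤ 1 + c ^ 2 * (‖h‖ * ‖k‖) :=
      (norm_add_le _ _).trans (by simp)
    refine (pow_le_pow_left₀ (norm_nonneg _) htriangle 2).trans ?_
    nlinarith [sq_nonneg (c * (‖h‖ - ‖k‖))]
  have hh' := norm_pos_iff.2 (one_sub_sq_mul_sq_ne_zero c hh)
  have hk' := norm_pos_iff.2 (one_sub_sq_mul_sq_ne_zero c hk)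
  rw [selfEnergy_sub c hh hk, norm_mul, norm_div, norm_mul, norm_mul, Complex.norm_real,
    selfEnergy_im, selfEnergy_im, mul_pow, mul_assoc]
  refine mul_le_mul_of_nonneg_left ?_ (sq_nonneg _)
  calc (‖c‖ * ‖1 + (c : ℂ) ^ 2 * (h * k)‖ /
        (‖1 - (c : ℂ) ^ 2 * h ^ 2‖ * ‖1 - (c : ℂ) ^ 2 * k ^ 2‖)) ^ 2 * (h.im * k.im)
      ≤ c ^ 2 * ((1 + c ^ 2 * ‖h‖ ^ 2) * (1 + c ^ 2 * ‖k‖ ^ 2)) /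
        (‖1 - (c : ℂ) ^ 2 * h ^ 2‖ * ‖1 - (c : ℂ) ^ 2 * k ^ 2‖) ^ 2 * (h.im * k.im) := by
        rw [div_pow, mul_pow, Real.norm_eq_abs, sq_abs]
        gcongr
    _ = _ := by
        field_simp

theorem add_mul_ne_zero_of_im (hr : 0 ≤ r) (hu : 0 < u.im) (hh : 0 ≤ h.im) : u + r * h ≠ 0 := by
  refine ne_zero_of_im_pos ?_
  rw [Complex.add_im, Complex.im_ofReal_mul]
  positivity

theorem continuousAt_selfEnergy (hh : 0 < h.im ∨ h = 0) : ContinuousAt (selfEnergy c) h := by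
  refine ContinuousAt.div (by fun_prop) (by fun_prop) ?_
  rcases hh with hh | rfl
  · exact one_sub_sq_mul_sq_ne_zero c hh
  · simp

theorem dressedResolvent_im (c r : ℝ) (u h : ℂ) :
    (dressedResolvent c r u h).im =
      ‖dressedResolvent c r u h‖ ^ 2 * (u.im + r * (selfEnergy c h).im) := by
  rw [dressedResolvent, neg_inv_im, norm_neg, Complex.add_im, Complex.im_ofReal_mul]

theorem dressedResolvent_neg (c r : ℝ) (u h : ℂ) :
    dressedResolvent c r (-u) (-h) = -dressedResolvent c r u h := by
  rw [dressedResolvent, dressedResolvent, selfEnergy_neg, mul_neg, ← neg_add, inv_neg]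

theorem dressedResolvent_ne_zero (hc : 0 ≤ c) (hr : 0 ≤ r) (hu : 0 < u.im) (hh : 0 ≤ h.im) :
    dressedResolvent c r u h ≠ 0 :=
  neg_ne_zero.2 (inv_ne_zero (add_mul_ne_zero_of_im hr hu (selfEnergy_im_nonneg hc hh)))

theorem dressedResolvent_sub (hc : 0 ≤ c) (hr : 0 ≤ r) (hu : 0 < u.im) (hh : 0 ≤ h.im)
    (hk : 0 ≤ k.im) :
    dressedResolvent c r u h - dressedResolvent c r u k = (selfEnergy c h - selfEnergy c k) *
      (r * (dressedResolvent c r u h * dressedResolvent c r u k)) := by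
  have hh' := add_mul_ne_zero_of_im hr hu (selfEnergy_im_nonneg hc hh)
  have hk' := add_mul_ne_zero_of_im hr hu (selfEnergy_im_nonneg hc hk)
  unfold dressedResolvent
  field_simp
  ring

theorem continuousAt_dressedResolvent (hc : 0 ≤ c) (hr : 0 ≤ r) (hu : 0 < u.im)
    (hh : 0 < h.im ∨ h = 0) : ContinuousAt (dressedResolvent c r u) h := by
  have hh' : 0 ≤ h.im := by rcases hh with hh | rfl <;> simp [*, le_of_lt]
  exact ((continuousAt_const.add (continuousAt_const.mul (continuousAt_selfEnergy hh))).inv₀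
    (add_mul_ne_zero_of_im hr hu (selfEnergy_im_nonneg hc hh'))).neg

theorem im_mul_norm_le_of_im_mul_norm_sq_le {τ : ℝ} (hτ : 0 ≤ τ) (c : ℝ) (hh : 0 < h.im)
    (hhτ : u.im * ‖h‖ ^ 2 ≤ τ * h.im) : u.im * ‖h‖ ≤ τ * ‖1 - (c : ℂ) ^ 2 * h ^ 2‖ := by
  have hn : 0 < ‖h‖ := norm_pos_iff.2 (ne_zero_of_im_pos hh)
  have him : h.im ≤ ‖h‖ * ‖1 - (c : ℂ) ^ 2 * h ^ 2‖ := by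
    have hconj : (starRingEnd ℂ h * (1 - (c : ℂ) ^ 2 * h ^ 2)).im =
        -(h.im * (1 + c ^ 2 * ‖h‖ ^ 2)) := by
      rw [Complex.sq_norm, Complex.normSq_apply]
      simp only [pow_two, Complex.mul_im, Complex.conj_re, Complex.sub_im, Complex.one_im,
        Complex.mul_re, Complex.ofReal_re, Complex.ofReal_im, mul_zero, sub_zero, zero_mul,
        add_zero, zero_sub, mul_neg, Complex.conj_im, Complex.sub_re, Complex.one_re, neg_mul]
      ring
    have hle := Complex.abs_im_le_norm (starRingEnd ℂ h * (1 - (c : ℂ) ^ 2 * h ^ 2))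
    rw [hconj, abs_neg, abs_of_nonneg (by positivity), norm_mul, RCLike.norm_conj] at hle
    have : 0 ≤ h.im * (c ^ 2 * ‖h‖ ^ 2) := by positivity
    linarith
  have := hhτ.trans (mul_le_mul_of_nonneg_left him hτ)
  refine le_of_mul_le_mul_left ?_ hn
  linarith

theorem im_mul_norm_selfEnergy_le {τ : ℝ} (hτ : 0 ≤ τ) (hc : 0 ≤ c) (hh : 0 < h.im)
    (hhτ : u.im * ‖h‖ ^ 2 ≤ τ * h.im) : u.im * ‖selfEnergy c h‖ ≤ c * τ := by
  rw [selfEnergy, norm_div, norm_mul, Complex.norm_real, Real.norm_of_nonneg hc, ← mul_div_assoc,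
    div_le_iff₀ (norm_pos_iff.2 (one_sub_sq_mul_sq_ne_zero c hh))]
  linarith [mul_le_mul_of_nonneg_left (im_mul_norm_le_of_im_mul_norm_sq_le hτ c hh hhτ) hc]

end SelfEnergy

section ResolventMap

variable {ι : Type*} [Fintype ι] {a r : ι → ℝ} {c : ℝ} {u h k : ℂ}

theorem resolventMap_neg (a r : ι → ℝ) (c : ℝ) (u h : ℂ) :
    resolventMap a r c (-u) (-h) = -resolventMap a r c u h := by
  simp only [resolventMap, dressedResolvent_neg, mul_neg, Finset.sum_neg_distrib]

theorem resolventMap_im (a r : ι → ℝ) (c : ℝ) (u h : ℂ) :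
    (resolventMap a r c u h).im =
      u.im * (∑ i, a i * ‖dressedResolvent c (r i) u h‖ ^ 2) + imTransfer a r c u h := by
  rw [resolventMap, imTransfer, Complex.im_sum, Finset.mul_sum, Finset.sum_mul,
    ← Finset.sum_add_distrib]
  refine Finset.sum_congr rfl fun i _ => ?_
  rw [Complex.im_ofReal_mul, dressedResolvent_im]
  ring

theorem imTransfer_nonneg (ha : ∀ i, 0 ≤ a i) (hr : ∀ i, 0 ≤ r i) (hc : 0 ≤ c) (u : ℂ)
    (hh : 0 ≤ h.im) : 0 ≤ imTransfer a r c u h :=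
  mul_nonneg
    (Finset.sum_nonneg fun i _ => mul_nonneg (mul_nonneg (ha i) (hr i)) (sq_nonneg _))
    (selfEnergy_im_nonneg hc hh)

theorem sum_mul_norm_dressedResolvent_sq_pos (ha : ∀ i, 0 ≤ a i) (hτ : 0 < ∑ i, a i)
    (hr : ∀ i, 0 ≤ r i) (hc : 0 ≤ c) (hu : 0 < u.im) (hh : 0 ≤ h.im) :
    0 < ∑ i, a i * ‖dressedResolvent c (r i) u h‖ ^ 2 := by
  obtain ⟨i, -, hi⟩ := (Finset.sum_pos_iff_of_nonneg fun i _ => ha i).1 hτ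
  refine Finset.sum_pos' (fun j _ => mul_nonneg (ha j) (sq_nonneg _)) ⟨i, Finset.mem_univ i, ?_⟩
  exact mul_pos hi (pow_pos (norm_pos_iff.2 (dressedResolvent_ne_zero hc (hr i) hu hh)) 2)

theorem imTransfer_lt_resolventMap_im (ha : ∀ i, 0 ≤ a i) (hτ : 0 < ∑ i, a i)
    (hr : ∀ i, 0 ≤ r i) (hc : 0 ≤ c) (hu : 0 < u.im) (hh : 0 ≤ h.im) :
    imTransfer a r c u h < (resolventMap a r c u h).im := by
  rw [resolventMap_im]
  exact lt_add_of_pos_left _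
    (mul_pos hu (sum_mul_norm_dressedResolvent_sq_pos ha hτ hr hc hu hh))

theorem resolventMap_im_pos (ha : ∀ i, 0 ≤ a i) (hτ : 0 < ∑ i, a i) (hr : ∀ i, 0 ≤ r i)
    (hc : 0 ≤ c) (hu : 0 < u.im) (hh : 0 ≤ h.im) : 0 < (resolventMap a r c u h).im :=
  (imTransfer_nonneg ha hr hc u hh).trans_lt (imTransfer_lt_resolventMap_im ha hτ hr hc hu hh)

theorem im_mul_norm_resolventMap_sq_le (ha : ∀ i, 0 ≤ a i) (hr : ∀ i, 0 ≤ r i) (hc : 0 ≤ c)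
    (hu : 0 ≤ u.im) (hh : 0 ≤ h.im) :
    u.im * ‖resolventMap a r c u h‖ ^ 2 ≤ (∑ i, a i) * (resolventMap a r c u h).im := by
  have hcs : ‖resolventMap a r c u h‖ ^ 2 ≤
      (∑ i, a i) * ∑ i, a i * ‖dressedResolvent c (r i) u h‖ ^ 2 := by
    simpa [resolventMap] using
      norm_sum_weighted_mul_sq_le Finset.univ (fun i _ => ha i) (fun _ => 1)
        fun i => dressedResolvent c (r i) u h
  rw [resolventMap_im, mul_add]
  have := mul_nonneg (Finset.sum_nonneg fun i (_ : i ∈ Finset.univ) => ha i)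
    (imTransfer_nonneg ha hr hc u hh)
  linarith [mul_le_mul_of_nonneg_left hcs hu]

theorem norm_resolventMap_sub_sq_le (ha : ∀ i, 0 ≤ a i) (hr : ∀ i, 0 ≤ r i) (hc : 0 ≤ c)
    (hu : 0 < u.im) (hh : 0 ≤ h.im) (hk : 0 ≤ k.im) :
    ‖resolventMap a r c u h - resolventMap a r c u k‖ ^ 2 ≤
      ‖selfEnergy c h - selfEnergy c k‖ ^ 2 *
        ((∑ i, a i * r i * ‖dressedResolvent c (r i) u h‖ ^ 2) *
          ∑ i, a i * r i * ‖dressedResolvent c (r i) u k‖ ^ 2) := by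
  have hsub : resolventMap a r c u h - resolventMap a r c u k =
      (selfEnergy c h - selfEnergy c k) * ∑ i, ((a i * r i : ℝ) : ℂ) *
        (dressedResolvent c (r i) u h * dressedResolvent c (r i) u k) := by
    rw [resolventMap, resolventMap, ← Finset.sum_sub_distrib, Finset.mul_sum]
    refine Finset.sum_congr rfl fun i _ => ?_
    rw [← mul_sub, dressedResolvent_sub hc (hr i) hu hh hk]
    push_cast
    ring
  rw [hsub, norm_mul, mul_pow]
  exact mul_le_mul_of_nonneg_left
    (norm_sum_weighted_mul_sq_le _ (fun i _ => mul_nonneg (ha i) (hr i)) _ _) (sq_nonneg _)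

/-- `resolventMap` contracts the hyperbolic distance, because `imTransfer` is smaller than the
imaginary part of its value. -/
theorem norm_resolventMap_sub_sq_mul_le (ha : ∀ i, 0 ≤ a i) (hr : ∀ i, 0 ≤ r i) (hc : 0 ≤ c)
    (hu : 0 < u.im) (hh : 0 < h.im) (hk : 0 < k.im) :
    ‖resolventMap a r c u h - resolventMap a r c u k‖ ^ 2 * (h.im * k.im) ≤
      ‖h - k‖ ^ 2 * (imTransfer a r c u h * imTransfer a r c u k) := by
  have hsum : ∀ w, 0 ≤ ∑ i, a i * r i * ‖dressedResolvent c (r i) u w‖ ^ 2 := fun w =>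
    Finset.sum_nonneg fun i _ => mul_nonneg (mul_nonneg (ha i) (hr i)) (sq_nonneg _)
  have h₁ := mul_le_mul_of_nonneg_right (norm_resolventMap_sub_sq_le ha hr hc hu hh.le hk.le)
    (mul_pos hh hk).le
  have h₂ := mul_le_mul_of_nonneg_right (norm_selfEnergy_sub_sq_mul_le c hh hk)
    (mul_nonneg (hsum h) (hsum k))
  unfold imTransfer
  linarith

theorem eq_of_resolventMap_eq_self (ha : ∀ i, 0 ≤ a i) (hτ : 0 < ∑ i, a i) (hr : ∀ i, 0 ≤ r i)
    (hc : 0 ≤ c) (hu : 0 < u.im) (hh : 0 < h.im) (hk : 0 < k.im)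
    (hfix : resolventMap a r c u h = h) (kfix : resolventMap a r c u k = k) : h = k := by
  have hcontr := norm_resolventMap_sub_sq_mul_le ha hr hc hu hh hk
  have hlt := imTransfer_lt_resolventMap_im ha hτ hr hc hu hh.le
  have klt := imTransfer_lt_resolventMap_im ha hτ hr hc hu hk.le
  rw [hfix] at hcontr hlt
  rw [kfix] at hcontr klt
  have hprod : imTransfer a r c u h * imTransfer a r c u k < h.im * k.im :=
    mul_lt_mul'' hlt klt (imTransfer_nonneg ha hr hc u hh.le) (imTransfer_nonneg ha hr hc u hk.le)
  by_contra hne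
  have : 0 < ‖h - k‖ ^ 2 := pow_pos (norm_pos_iff.2 (sub_ne_zero.2 hne)) 2
  exact absurd hcontr (not_le.2 (mul_lt_mul_of_pos_left hprod this))

theorem exists_imTransfer_le_mul_im (ha : ∀ i, 0 ≤ a i) (hr : ∀ i, 0 ≤ r i) (hc : 0 ≤ c)
    (hu : 0 < u.im) :
    ∃ ρ : ℝ, 0 ≤ ρ ∧ ρ < 1 ∧ ∀ h : ℂ, 0 < h.im → u.im * ‖h‖ ^ 2 ≤ (∑ i, a i) * h.im →
      imTransfer a r c u h ≤ ρ * (resolventMap a r c u h).im := by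
  set W := c * (∑ i, a i) / u.im
  have hτ : 0 ≤ ∑ i, a i := Finset.sum_nonneg fun i _ => ha i
  have hb : 0 ≤ ∑ i, r i := Finset.sum_nonneg fun i _ => hr i
  have : 0 ≤ (∑ i, r i) * W := by positivity
  refine ⟨(∑ i, r i) * W / (u.im + (∑ i, r i) * W), by positivity,
    (div_lt_one (by positivity)).2 (by linarith), fun h hh hhτ => ?_⟩
  set Γ := ∑ i, a i * ‖dressedResolvent c (r i) u h‖ ^ 2
  have hΓ : 0 ≤ Γ := Finset.sum_nonneg fun i _ => mul_nonneg (ha i) (sq_nonneg _)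
  have hσ : (selfEnergy c h).im ≤ W := by
    rw [le_div_iff₀ hu, mul_comm]
    exact (mul_le_mul_of_nonneg_left (Complex.im_le_norm _) hu.le).trans
      (im_mul_norm_selfEnergy_le hτ hc hh hhτ)
  have hsum : ∑ i, a i * r i * ‖dressedResolvent c (r i) u h‖ ^ 2 ≤ (∑ i, r i) * Γ := by
    rw [Finset.mul_sum]
    refine Finset.sum_le_sum fun i _ => ?_
    rw [mul_comm (a i), mul_assoc]
    exact mul_le_mul_of_nonneg_right
      (Finset.single_le_sum (fun j _ => hr j) (Finset.mem_univ i))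
      (mul_nonneg (ha i) (sq_nonneg _))
  have htransfer : imTransfer a r c u h ≤ (∑ i, r i) * Γ * W :=
    mul_le_mul hsum hσ (selfEnergy_im_nonneg hc hh.le) (mul_nonneg hb hΓ)
  rw [resolventMap_im, div_mul_eq_mul_div, le_div_iff₀ (by positivity)]
  linarith [mul_le_mul_of_nonneg_left htransfer hu.le]

theorem continuousAt_resolventMap (hr : ∀ i, 0 ≤ r i) (hc : 0 ≤ c) (hu : 0 < u.im)
    (hh : 0 < h.im ∨ h = 0) : ContinuousAt (resolventMap a r c u) h :=
  tendsto_finsetSum _ fun i _ =>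
    continuousAt_const.mul (continuousAt_dressedResolvent hc (hr i) hu hh)

theorem iterate_resolventMap_im_pos (ha : ∀ i, 0 ≤ a i) (hτ : 0 < ∑ i, a i) (hr : ∀ i, 0 ≤ r i)
    (hc : 0 ≤ c) (hu : 0 < u.im) (n : ℕ) : 0 < ((resolventMap a r c u)^[n + 1] 0).im := by
  induction n with
  | zero => exact resolventMap_im_pos ha hτ hr hc hu le_rfl
  | succ n ih =>
    rw [Function.iterate_succ_apply']
    exact resolventMap_im_pos ha hτ hr hc hu ih.le

theorem im_mul_norm_iterate_resolventMap_sq_le (ha : ∀ i, 0 ≤ a i) (hτ : 0 < ∑ i, a i)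
    (hr : ∀ i, 0 ≤ r i) (hc : 0 ≤ c) (hu : 0 < u.im) (n : ℕ) :
    u.im * ‖(resolventMap a r c u)^[n + 1] 0‖ ^ 2 ≤
      (∑ i, a i) * ((resolventMap a r c u)^[n + 1] 0).im := by
  rw [Function.iterate_succ_apply']
  refine im_mul_norm_resolventMap_sq_le ha hr hc hu.le ?_
  cases n with
  | zero => exact le_rfl
  | succ n => exact (iterate_resolventMap_im_pos ha hτ hr hc hu n).le

theorem norm_le_div_of_im_mul_norm_sq_le {τ : ℝ} (hu : 0 < u.im) (hh : 0 < h.im)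
    (hhτ : u.im * ‖h‖ ^ 2 ≤ τ * h.im) : ‖h‖ ≤ τ / u.im := by
  have hn : 0 < ‖h‖ := norm_pos_iff.2 (ne_zero_of_im_pos hh)
  have hτh : 0 ≤ τ * h.im := le_trans (by positivity) hhτ
  have hτ : 0 ≤ τ := nonneg_of_mul_nonneg_left hτh hh
  rw [le_div_iff₀ hu]
  refine le_of_mul_le_mul_right ?_ hn
  linarith [mul_le_mul_of_nonneg_left (Complex.im_le_norm h) hτ]

theorem cauchySeq_iterate_resolventMap (ha : ∀ i, 0 ≤ a i) (hτ : 0 < ∑ i, a i)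
    (hr : ∀ i, 0 ≤ r i) (hc : 0 ≤ c) (hu : 0 < u.im) :
    CauchySeq fun n => (resolventMap a r c u)^[n + 1] 0 := by
  obtain ⟨ρ, hρ₀, hρ₁, hρ⟩ := exists_imTransfer_le_mul_im ha hr hc hu
  have hpos := iterate_resolventMap_im_pos ha hτ hr hc hu
  have hmem := im_mul_norm_iterate_resolventMap_sq_le ha hτ hr hc hu
  refine cauchySeq_of_hyperbolic_contraction hρ₀ hρ₁ hpos
    (fun n => (Complex.im_le_norm _).trans
      (norm_le_div_of_im_mul_norm_sq_le hu (hpos n) (hmem n))) fun n => ?_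
  have hcontr := norm_resolventMap_sub_sq_mul_le ha hr hc hu (hpos (n + 1)) (hpos n)
  have htransfer := mul_le_mul (hρ _ (hpos (n + 1)) (hmem (n + 1))) (hρ _ (hpos n) (hmem n))
    (imTransfer_nonneg ha hr hc u (hpos n).le)
    (mul_nonneg hρ₀ (resolventMap_im_pos ha hτ hr hc hu (hpos (n + 1)).le).le)
  simp only [← Function.iterate_succ_apply' (resolventMap a r c u)] at hcontr htransfer
  refine hcontr.trans ((mul_le_mul_of_nonneg_left htransfer (sq_nonneg _)).trans (le_of_eq ?_))
  ring

theorem exists_tendsto_iterate_resolventMap (ha : ∀ i, 0 ≤ a i) (hτ : 0 < ∑ i, a i)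
    (hr : ∀ i, 0 ≤ r i) (hc : 0 ≤ c) (hu : 0 < u.im) :
    ∃ h : ℂ, 0 < h.im ∧ resolventMap a r c u h = h ∧
      Tendsto (fun n => (resolventMap a r c u)^[n + 1] 0) atTop (𝓝 h) := by
  obtain ⟨h, hlim⟩ :=
    cauchySeq_tendsto_of_complete (cauchySeq_iterate_resolventMap ha hτ hr hc hu)
  have hmem : u.im * ‖h‖ ^ 2 ≤ (∑ i, a i) * h.im :=
    le_of_tendsto_of_tendsto' ((hlim.norm.pow 2).const_mul _)
      (((Complex.continuous_im.tendsto h).comp hlim).const_mul _)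
      (im_mul_norm_iterate_resolventMap_sq_le ha hτ hr hc hu)
  have hdich : 0 < h.im ∨ h = 0 := or_iff_not_imp_right.2 fun h0 =>
    pos_of_mul_pos_right
      ((mul_pos hu (pow_pos (norm_pos_iff.2 h0) 2)).trans_le hmem) hτ.le
  have hfix : resolventMap a r c u h = h := by
    have hcomp := (continuousAt_resolventMap (a := a) hr hc hu hdich).tendsto.comp hlim
    refine tendsto_nhds_unique hcomp ((hlim.comp (tendsto_add_atTop_nat 1)).congr fun n => ?_)
    exact Function.iterate_succ_apply' (resolventMap a r c u) (n + 1) 0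
  rcases hdich with hh | rfl
  · exact ⟨h, hh, hfix, hlim⟩
  · have := resolventMap_im_pos (h := 0) ha hτ hr hc hu le_rfl
    rw [hfix] at this
    exact absurd this (lt_irrefl _)

end ResolventMap

/-- On `Im u ≠ 0`, `f` is the Stieltjes transform of finitely many atoms with total mass `τ` and
second moment `κ`. -/
def IsAtomicStieltjes (τ κ : ℝ) (f : ℂ → ℂ) : Prop :=
  ∃ (J : Type) (_ : Fintype J) (p l : J → ℝ), (∀ j, 0 ≤ p j) ∧ ∑ j, p j = τ ∧
    ∑ j, p j * l j ^ 2 = κ ∧ ∀ u : ℂ, u.im ≠ 0 → f u = ∑ j, (p j : ℂ) / (l j - u)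

theorem ofReal_sub_ne_zero {z : ℂ} (hz : z.im ≠ 0) (x : ℝ) : (x : ℂ) - z ≠ 0 := fun H =>
  hz (by simpa using congrArg Complex.im H)

theorem isAtomicStieltjes_inner_of_isSymmetric {E : Type*} [NormedAddCommGroup E]
    [InnerProductSpace ℂ E] [FiniteDimensional ℂ E] {T : E →ₗ[ℂ] E} (hT : T.IsSymmetric) {v : E}
    {x : ℂ → E} (hx : ∀ u : ℂ, u.im ≠ 0 → T (x u) - u • x u = v) :
    IsAtomicStieltjes (‖v‖ ^ 2) (‖T v‖ ^ 2) fun u => inner ℂ v (x u) := by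
  set e := hT.eigenvectorBasis rfl
  set l := hT.eigenvalues rfl
  have heT : ∀ j w, inner ℂ (e j) (T w) = l j * inner ℂ (e j) w := fun j w => by
    rw [← hT, hT.apply_eigenvectorBasis rfl j, inner_smul_left, RCLike.conj_ofReal]
    rfl
  refine ⟨Fin (Module.finrank ℂ E), inferInstance, fun j => ‖inner ℂ (e j) v‖ ^ 2, l,
    fun j => sq_nonneg _, e.sum_sq_norm_inner_right v, ?_, fun u hu => ?_⟩
  · rw [← e.sum_sq_norm_inner_right (T v)]
    refine Finset.sum_congr rfl fun j _ => ?_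
    rw [heT, norm_mul, Complex.norm_real, mul_pow, Real.norm_eq_abs, sq_abs, mul_comm]
  · beta_reduce
    rw [← e.sum_inner_mul_inner]
    refine Finset.sum_congr rfl fun j _ => ?_
    have hcoord : inner ℂ (e j) v = (l j - u) * inner ℂ (e j) (x u) := by
      rw [← hx u hu, inner_sub_right, heT, inner_smul_right, sub_mul]
    rw [eq_div_iff (ofReal_sub_ne_zero hu _), mul_assoc, mul_comm (inner ℂ (e j) (x u)), ← hcoord,
      ← inner_conj_symm v, mul_comm, Complex.mul_conj, Complex.normSq_eq_norm_sq]

theorem isAtomicStieltjes_dotProduct_of_isHermitian {J : Type*} [Fintype J]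
    {A : Matrix J J ℂ} (hA : A.IsHermitian) {v : J → ℂ} {x : ℂ → J → ℂ}
    (hx : ∀ u : ℂ, u.im ≠ 0 → A.mulVec (x u) - u • x u = v) :
    IsAtomicStieltjes (∑ j, ‖v j‖ ^ 2) (∑ j, ‖A.mulVec v j‖ ^ 2) fun u => x u ⬝ᵥ star v := by
  classical
  have h := isAtomicStieltjes_inner_of_isSymmetric (Matrix.isSymmetric_toEuclideanLin_iff.2 hA)
    (v := WithLp.toLp 2 v) (x := fun u => WithLp.toLp 2 (x u)) fun u hu => by
      rw [Matrix.toEuclideanLin, Matrix.toLpLin_toLp, Matrix.toLin'_apply, ← WithLp.toLp_smul,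
        ← WithLp.toLp_sub, hx u hu]
  simpa only [Matrix.toEuclideanLin, Matrix.toLpLin_toLp, Matrix.toLin'_apply,
    EuclideanSpace.norm_sq_eq, EuclideanSpace.inner_eq_star_dotProduct] using h

theorem sum_norm_sqrt_sq {J : Type*} [Fintype J] {p : J → ℝ} (hp : ∀ j, 0 ≤ p j) :
    ∑ j, ‖(√(p j) : ℂ)‖ ^ 2 = ∑ j, p j :=
  Finset.sum_congr rfl fun j _ => by
    rw [Complex.norm_real, Real.norm_eq_abs, sq_abs, Real.sq_sqrt (hp j)]

theorem sum_sqrt_mul_sqrt_div {J : Type*} [Fintype J] {p : J → ℝ} (hp : ∀ j, 0 ≤ p j) (l : J → ℝ)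
    (u : ℂ) :
    ∑ j, (√(p j) : ℂ) * ((√(p j) : ℂ) / (l j - u)) = ∑ j, (p j : ℂ) / (l j - u) :=
  Finset.sum_congr rfl fun j _ => by
    rw [← mul_div_assoc, ← Complex.ofReal_mul, Real.mul_self_sqrt (hp j)]

theorem fromBlocks_replicateRow_replicateCol_diagonal_mulVec {R J : Type*} [CommRing R] [Fintype J]
    [DecidableEq J] (s d w : J → R) (α : R) :
    (Matrix.fromBlocks (0 : Matrix Unit Unit R) (Matrix.replicateRow Unit s)
        (Matrix.replicateCol Unit s) (Matrix.diagonal d)).mulVec (Sum.elim (fun _ => α) w) =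
      Sum.elim (fun _ => s ⬝ᵥ w) fun j => s j * α + d j * w j := by
  rw [Matrix.fromBlocks_mulVec, Sum.elim_comp_inl, Sum.elim_comp_inr, Matrix.zero_mulVec, zero_add]
  ext (i | j)
  · rfl
  · simp only [Sum.elim_inr, Pi.add_apply, Matrix.mulVec_diagonal, add_left_inj]
    simp only [Matrix.mulVec, dotProduct, Matrix.replicateCol_apply, Finset.univ_unique,
      Finset.sum_singleton]

namespace IsAtomicStieltjes

variable {τ κ τ' κ' : ℝ} {f f' : ℂ → ℂ}

theorem congr (h : IsAtomicStieltjes τ κ f) (hf : ∀ u : ℂ, u.im ≠ 0 → f' u = f u) :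
    IsAtomicStieltjes τ κ f' := by
  obtain ⟨J, _, p, l, hp, hτ, hκ, h⟩ := h
  exact ⟨J, inferInstance, p, l, hp, hτ, hκ, fun u hu => (hf u hu).trans (h u hu)⟩

theorem zero : IsAtomicStieltjes 0 0 fun _ => 0 :=
  ⟨Empty, inferInstance, fun _ => 0, fun _ => 0, fun _ => le_rfl, by simp, by simp, by simp⟩

theorem add (h : IsAtomicStieltjes τ κ f) (h' : IsAtomicStieltjes τ' κ' f') :
    IsAtomicStieltjes (τ + τ') (κ + κ') fun u => f u + f' u := by
  obtain ⟨J, _, p, l, hp, rfl, rfl, h⟩ := h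
  obtain ⟨J', _, p', l', hp', rfl, rfl, h'⟩ := h'
  refine ⟨J ⊕ J', inferInstance, Sum.elim p p', Sum.elim l l', Sum.rec hp hp', ?_, ?_,
    fun u hu => ?_⟩
  · simp only [Fintype.sum_sum_type, Sum.elim_inl, Sum.elim_inr]
  · simp only [Fintype.sum_sum_type, Sum.elim_inl, Sum.elim_inr]
  · simp only [Fintype.sum_sum_type, Sum.elim_inl, Sum.elim_inr, h u hu, h' u hu]

theorem const_mul (h : IsAtomicStieltjes τ κ f) {t : ℝ} (ht : 0 ≤ t) :
    IsAtomicStieltjes (t * τ) (t * κ) fun u => t * f u := by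
  obtain ⟨J, _, p, l, hp, rfl, rfl, h⟩ := h
  refine ⟨J, inferInstance, fun j => t * p j, l, fun j => mul_nonneg ht (hp j), ?_, ?_,
    fun u hu => ?_⟩
  · rw [Finset.mul_sum]
  · simp only [Finset.mul_sum, mul_assoc]
  · simp only [h u hu, Finset.mul_sum, Complex.ofReal_mul, mul_div_assoc]

theorem sum {ι : Type*} (s : Finset ι) {τ κ : ι → ℝ} {f : ι → ℂ → ℂ}
    (h : ∀ i ∈ s, IsAtomicStieltjes (τ i) (κ i) (f i)) :
    IsAtomicStieltjes (∑ i ∈ s, τ i) (∑ i ∈ s, κ i) fun u => ∑ i ∈ s, f i u := by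
  classical
  induction s using Finset.induction_on with
  | empty => simpa using zero
  | insert i s hi ih =>
    simp only [Finset.sum_insert hi]
    exact (h i (Finset.mem_insert_self i s)).add
      (ih fun j hj => h j (Finset.mem_insert_of_mem hj))

theorem im_mul_im_pos (h : IsAtomicStieltjes τ κ f) {u : ℂ} (hu : u.im ≠ 0) (hf : f u ≠ 0) :
    0 < u.im * (f u).im := by
  obtain ⟨J, _, p, l, hp, -, -, h⟩ := h
  have him : u.im * (f u).im = ∑ j, p j * (u.im ^ 2 / Complex.normSq (l j - u)) := by
    rw [h u hu, Complex.im_sum, Finset.mul_sum]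
    refine Finset.sum_congr rfl fun j _ => ?_
    rw [div_eq_mul_inv, Complex.im_ofReal_mul, Complex.inv_im, Complex.sub_im, Complex.ofReal_im]
    ring
  have hpos : ∀ j, 0 < u.im ^ 2 / Complex.normSq (l j - u) := fun j =>
    div_pos (by positivity) (Complex.normSq_pos.2 (ofReal_sub_ne_zero hu _))
  have hne : ∃ j, p j ≠ 0 := by
    by_contra! hzero
    exact hf (by simp [h u hu, hzero])
  obtain ⟨j, hj⟩ := hne
  rw [him]
  exact Finset.sum_pos' (fun i _ => mul_nonneg (hp i) (hpos i).le)
    ⟨j, Finset.mem_univ j, mul_pos ((hp j).lt_of_ne' hj) (hpos j)⟩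

theorem one_sub_mul_ne_zero (h : IsAtomicStieltjes τ κ f) (c : ℝ) {u : ℂ} (hu : u.im ≠ 0) :
    1 - c * f u ≠ 0 := fun H => by
  have hcf : (c : ℂ) * f u = 1 := (sub_eq_zero.1 H).symm
  have him : c * (f u).im = 0 := by simpa using congrArg Complex.im hcf
  have hc : c ≠ 0 := by rintro rfl; simp at hcf
  have hpos := h.im_mul_im_pos hu (right_ne_zero_of_mul (hcf ▸ one_ne_zero))
  simp [(mul_eq_zero.1 him).resolve_left hc] at hpos

theorem add_ne_zero (h : IsAtomicStieltjes τ κ f) {u : ℂ} (hu : u.im ≠ 0) : u + f u ≠ 0 :=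
  fun H => by
  have hf : f u = -u := (neg_eq_of_add_eq_zero_right H).symm
  have hpos := h.im_mul_im_pos hu (by rintro h0; simp_all)
  rw [hf, Complex.neg_im] at hpos
  nlinarith [sq_nonneg u.im]

/-- The atoms are the eigenvalues of the rank-one perturbation `diag l - c s sᵀ`, where `s = √p`. -/
theorem div_one_sub_mul (h : IsAtomicStieltjes τ κ f) (c : ℝ) :
    ∃ κ', IsAtomicStieltjes τ κ' fun u => f u / (1 - c * f u) := by
  classical
  have hne := fun (u : ℂ) (hu : u.im ≠ 0) => h.one_sub_mul_ne_zero c hu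
  obtain ⟨J, _, p, l, hp, rfl, -, h⟩ := h
  set s : J → ℂ := fun j => (√(p j) : ℂ)
  have hstar : star s = s := funext fun j => Complex.conj_ofReal _
  have hA :
      (Matrix.diagonal (fun j => (l j : ℂ)) - (c : ℂ) • Matrix.vecMulVec s s).IsHermitian := by
    refine (Matrix.isHermitian_diagonal_of_self_adjoint _ (funext fun j =>
      Complex.conj_ofReal _)).sub ?_
    rw [Matrix.IsHermitian, Matrix.conjTranspose_smul, Matrix.conjTranspose_vecMulVec, hstar,
      Complex.star_def, Complex.conj_ofReal]
  have hdot : ∀ u : ℂ, u.im ≠ 0 →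
      s ⬝ᵥ (fun j => s j / (l j - u) / (1 - c * f u)) = f u / (1 - c * f u) := fun u hu => by
    rw [h u hu, ← sum_sqrt_mul_sqrt_div hp, Finset.sum_div]
    exact Finset.sum_congr rfl fun j _ => (mul_div_assoc _ _ _).symm
  have hatoms := isAtomicStieltjes_dotProduct_of_isHermitian hA (v := s)
    (x := fun u j => s j / (l j - u) / (1 - c * f u)) fun u hu => by
      have hcf := hne u hu
      ext j
      have hl := ofReal_sub_ne_zero hu (l j)
      simp only [Matrix.sub_mulVec, Matrix.smul_mulVec, Matrix.vecMulVec_mulVec, hdot u hu,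
        Pi.sub_apply, Pi.smul_apply, Matrix.mulVec_diagonal, MulOpposite.smul_eq_mul_unop,
        MulOpposite.unop_op, smul_eq_mul]
      field_simp
      ring
  rw [sum_norm_sqrt_sq hp] at hatoms
  refine ⟨_, hatoms.congr fun u hu => ?_⟩
  rw [hstar, dotProduct_comm, hdot u hu]

/-- The atoms are the eigenvalues of the bordered matrix `[[0, sᵀ], [s, diag l]]`, where `s = √p`:
the Schur complement formula. -/
theorem neg_inv_add (h : IsAtomicStieltjes τ κ f) :
    IsAtomicStieltjes 1 τ fun u => -(u + f u)⁻¹ := by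
  classical
  have hne := fun (u : ℂ) (hu : u.im ≠ 0) => h.add_ne_zero hu
  obtain ⟨J, _, p, l, hp, rfl, -, h⟩ := h
  set s : J → ℂ := fun j => (√(p j) : ℂ)
  have hA : (Matrix.fromBlocks (0 : Matrix Unit Unit ℂ) (Matrix.replicateRow Unit s)
      (Matrix.replicateCol Unit s) (Matrix.diagonal fun j => (l j : ℂ))).IsHermitian := by
    refine Matrix.IsHermitian.fromBlocks Matrix.isHermitian_zero ?_
      (Matrix.isHermitian_diagonal_of_self_adjoint _ (funext fun j => Complex.conj_ofReal _))
    rw [Matrix.conjTranspose_replicateRow]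
    exact congrArg _ (funext fun j => Complex.conj_ofReal _)
  have hdot : ∀ u : ℂ, u.im ≠ 0 →
      s ⬝ᵥ (fun j => (u + f u)⁻¹ * (s j / (l j - u))) = (u + f u)⁻¹ * f u := fun u hu => by
    rw [h u hu, ← sum_sqrt_mul_sqrt_div hp, Finset.mul_sum]
    exact Finset.sum_congr rfl fun j _ => mul_left_comm _ _ _
  have hatoms := isAtomicStieltjes_dotProduct_of_isHermitian hA (v := Sum.elim (fun _ => 1) 0)
    (x := fun u => Sum.elim (fun _ => -(u + f u)⁻¹) fun j => (u + f u)⁻¹ * (s j / (l j - u)))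
    fun u hu => by
      rw [fromBlocks_replicateRow_replicateCol_diagonal_mulVec, hdot u hu]
      ext (i | j)
      · have huf := hne u hu
        simp only [Pi.sub_apply, Pi.smul_apply, Sum.elim_inl, smul_eq_mul]
        field_simp
        ring
      · have hl := ofReal_sub_ne_zero hu (l j)
        simp only [Pi.sub_apply, Pi.smul_apply, Sum.elim_inr, smul_eq_mul, Pi.zero_apply]
        field_simp
        ring
  rw [fromBlocks_replicateRow_replicateCol_diagonal_mulVec] at hatoms
  convert hatoms using 1
  · simp
  · simp [← sum_norm_sqrt_sq hp, s]
  · ext u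
    simp [dotProduct]

theorem exists_selfEnergy_comp (h : IsAtomicStieltjes τ κ f) {c : ℝ} (hc : 0 ≤ c) :
    ∃ κ', IsAtomicStieltjes (c * τ) κ' fun u => selfEnergy c (f u) := by
  obtain ⟨κ₁, h₁⟩ := h.div_one_sub_mul c
  obtain ⟨κ₂, h₂⟩ := h.div_one_sub_mul (-c)
  refine ⟨c / 2 * (κ₁ + κ₂), ?_⟩
  rw [show c * τ = c / 2 * (τ + τ) by ring]
  refine ((h₁.add h₂).const_mul (div_nonneg hc zero_le_two)).congr fun u hu => ?_
  have hsub := h.one_sub_mul_ne_zero c hu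
  have hadd := h.one_sub_mul_ne_zero (-c) hu
  simp only [Complex.ofReal_neg, Complex.ofReal_div, Complex.ofReal_ofNat, neg_mul,
    sub_neg_eq_add] at hadd ⊢
  have hprod : 1 - (c : ℂ) ^ 2 * f u ^ 2 = (1 - c * f u) * (1 + c * f u) := by ring
  rw [selfEnergy, hprod]
  field_simp
  ring

theorem dressedResolvent_comp (h : IsAtomicStieltjes τ κ f) {c r : ℝ} (hc : 0 ≤ c) (hr : 0 ≤ r) :
    IsAtomicStieltjes 1 (r * (c * τ)) fun u => dressedResolvent c r u (f u) := by
  obtain ⟨κ', h'⟩ := h.exists_selfEnergy_comp hc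
  exact (h'.const_mul hr).neg_inv_add

theorem resolventMap_comp {ι : Type*} [Fintype ι] {a r : ι → ℝ} {c : ℝ} (ha : ∀ i, 0 ≤ a i)
    (hr : ∀ i, 0 ≤ r i) (hc : 0 ≤ c) (h : IsAtomicStieltjes τ κ f) :
    IsAtomicStieltjes (∑ i, a i) (∑ i, a i * (r i * (c * τ)))
      fun u => resolventMap a r c u (f u) := by
  simpa only [mul_one, resolventMap] using
    sum Finset.univ fun i _ => (h.dressedResolvent_comp hc (hr i)).const_mul (ha i)

end IsAtomicStieltjes

theorem exists_isAtomicStieltjes_iterate_resolventMap {ι : Type*} [Fintype ι] {a r : ι → ℝ} {c : ℝ}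
    (ha : ∀ i, 0 ≤ a i) (hr : ∀ i, 0 ≤ r i) (hc : 0 ≤ c) (n : ℕ) :
    ∃ κ, IsAtomicStieltjes (∑ i, a i) κ fun u => (resolventMap a r c u)^[n + 1] 0 := by
  induction n with
  | zero => exact ⟨_, IsAtomicStieltjes.zero.resolventMap_comp ha hr hc⟩
  | succ n ih =>
    obtain ⟨κ, h⟩ := ih
    exact ⟨_, by simpa only [Function.iterate_succ_apply'] using h.resolventMap_comp ha hr hc⟩

theorem iterate_resolventMap_neg {ι : Type*} [Fintype ι] (a r : ι → ℝ) (c : ℝ) (u : ℂ) (n : ℕ) :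
    (resolventMap a r c (-u))^[n] 0 = -(resolventMap a r c u)^[n] 0 := by
  induction n with
  | zero => simp
  | succ n ih => rw [Function.iterate_succ_apply', Function.iterate_succ_apply', ih,
      resolventMap_neg]

theorem norm_inv_ofReal_sub_le {z : ℂ} (hz : z.im ≠ 0) (x : ℝ) :
    ‖((x : ℂ) - z)⁻¹‖ ≤ |z.im|⁻¹ := by
  rw [norm_inv]
  refine inv_anti₀ (abs_pos.2 hz) ?_
  simpa using Complex.abs_im_le_norm ((x : ℂ) - z)

theorem continuous_inv_ofReal_sub {z : ℂ} (hz : z.im ≠ 0) :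
    Continuous fun x : ℝ => ((x : ℂ) - z)⁻¹ :=
  Continuous.inv₀ (by fun_prop) (ofReal_sub_ne_zero hz)

theorem integrable_inv_ofReal_sub {z : ℂ} (hz : z.im ≠ 0) (μ : Measure ℝ) [IsFiniteMeasure μ] :
    Integrable (fun x : ℝ => ((x : ℂ) - z)⁻¹) μ :=
  Integrable.of_bound (continuous_inv_ofReal_sub hz).aestronglyMeasurable _
    (Eventually.of_forall (norm_inv_ofReal_sub_le hz))

theorem inv_ofReal_sub_im (x : ℝ) (z : ℂ) :
    (((x : ℂ) - z)⁻¹).im = z.im / Complex.normSq (x - z) := by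
  rw [Complex.inv_im, Complex.sub_im, Complex.ofReal_im, zero_sub, neg_neg]

/-- The combination `∑ wᵢ νᵢ` of measures with real weights; a negative weight counts as `0`. -/
noncomputable def weightedMeasure {ι α : Type*} [Fintype ι] [MeasurableSpace α] (w : ι → ℝ)
    (ν : ι → Measure α) : Measure α :=
  ∑ i, ENNReal.ofReal (w i) • ν i

section WeightedMeasure

variable {ι α : Type*} [Fintype ι] [MeasurableSpace α] {w : ι → ℝ} {ν : ι → Measure α}

instance [∀ i, IsFiniteMeasure (ν i)] : IsFiniteMeasure (weightedMeasure w ν) := by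
  have := fun i => (ν i).smul_finite (c := ENNReal.ofReal (w i)) ENNReal.ofReal_ne_top
  unfold weightedMeasure
  infer_instance

theorem ae_weightedMeasure {p : α → Prop} (h : ∀ i, ∀ᵐ x ∂ν i, p x) :
    ∀ᵐ x ∂weightedMeasure w ν, p x := by
  rw [weightedMeasure, ← Measure.sum_fintype, Measure.ae_sum_iff]
  exact fun i => Measure.ae_smul_measure (h i) _

theorem weightedMeasure_real_apply [∀ i, IsFiniteMeasure (ν i)] (hw : ∀ i, 0 ≤ w i) (s : Set α) :
    (weightedMeasure w ν).real s = ∑ i, w i * (ν i).real s := by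
  simp only [weightedMeasure, measureReal_def, Measure.coe_finsetSum, Finset.sum_apply,
    Measure.smul_apply, smul_eq_mul]
  rw [ENNReal.toReal_sum fun i _ => ENNReal.mul_ne_top ENNReal.ofReal_ne_top (measure_ne_top _ _)]
  exact Finset.sum_congr rfl fun i _ => by rw [ENNReal.toReal_mul, ENNReal.toReal_ofReal (hw i)]

theorem integrable_weightedMeasure {E : Type*} [NormedAddCommGroup E] {f : α → E}
    (hf : ∀ i, Integrable f (ν i)) : Integrable f (weightedMeasure w ν) :=
  integrable_finsetSum_measure.2 fun i _ => (hf i).smul_measure ENNReal.ofReal_ne_top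

theorem integral_weightedMeasure {E : Type*} [NormedAddCommGroup E] [NormedSpace ℝ E] {f : α → E}
    (hw : ∀ i, 0 ≤ w i) (hf : ∀ i, Integrable f (ν i)) :
    ∫ x, f x ∂weightedMeasure w ν = ∑ i, w i • ∫ x, f x ∂ν i := by
  rw [weightedMeasure, integral_finsetSum_measure fun i _ =>
    (hf i).smul_measure ENNReal.ofReal_ne_top]
  exact Finset.sum_congr rfl fun i _ => by
    rw [integral_smul_measure, ENNReal.toReal_ofReal (hw i)]

end WeightedMeasure

/-- Averaging `f u` with `-f (-u)` symmetrizes the atoms `l`, and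
`(1 / (l - u) - 1 / (l + u)) / 2 = u / (l ^ 2 - u ^ 2)`. -/
theorem IsAtomicStieltjes.exists_measure_of_odd {τ κ : ℝ} {f : ℂ → ℂ} (h : IsAtomicStieltjes τ κ f)
    (hodd : ∀ u, f (-u) = -f u) :
    ∃ ν : Measure ℝ, IsFiniteMeasure ν ∧ ν.real Set.univ = τ ∧ (∀ᵐ x ∂ν, 0 ≤ x) ∧
      Integrable (fun x => x) ν ∧ ∫ x, x ∂ν = κ ∧
      ∀ u : ℂ, u.im ≠ 0 → (u ^ 2).im ≠ 0 → f u = u * ∫ x : ℝ, ((x : ℂ) - u ^ 2)⁻¹ ∂ν := by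
  obtain ⟨J, _, p, l, hp, rfl, rfl, h⟩ := h
  have hint : ∀ j, Integrable (fun x : ℝ => x) (Measure.dirac (l j ^ 2)) := fun j =>
    integrable_dirac enorm_lt_top
  refine ⟨weightedMeasure p fun j => Measure.dirac (l j ^ 2), inferInstance, ?_,
    ae_weightedMeasure fun j => ?_, integrable_weightedMeasure hint, ?_,
    fun u hu hu2 => ?_⟩
  · simp [weightedMeasure_real_apply hp]
  · exact (ae_dirac_iff measurableSet_Ici).2 (sq_nonneg (l j))
  · simp only [integral_weightedMeasure hp hint, integral_dirac, smul_eq_mul]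
  · have hsym : f u = (∑ j, (p j : ℂ) / (l j - u) - ∑ j, (p j : ℂ) / (l j - -u)) / 2 := by
      rw [← h u hu, ← h (-u) (by simpa using hu), hodd]
      ring
    rw [integral_weightedMeasure hp fun j => integrable_inv_ofReal_sub hu2 _, hsym,
      ← Finset.sum_sub_distrib, Finset.mul_sum, Finset.sum_div]
    refine Finset.sum_congr rfl fun j _ => ?_
    have hsub := ofReal_sub_ne_zero hu (l j)
    have hadd := ofReal_sub_ne_zero (z := -u) (by simpa using hu) (l j)
    have hfactor : ((l j ^ 2 : ℝ) : ℂ) - u ^ 2 = (l j - u) * (l j - -u) := by push_cast; ring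
    rw [integral_dirac, hfactor, Complex.real_smul]
    field_simp
    ring

theorem isTightMeasureSet_of_integral_abs_le {S : Set (Measure ℝ)} {C : ℝ}
    (hint : ∀ μ ∈ S, Integrable (fun x => x) μ) (hC : ∀ μ ∈ S, ∫ x, |x| ∂μ ≤ C) :
    IsTightMeasureSet S := by
  refine isTightMeasureSet_of_tendsto_measure_norm_gt ?_
  have hmarkov : ∀ r : ℝ, 0 < r → ⨆ μ ∈ S, μ {x | r < ‖x‖} ≤ ENNReal.ofReal (C / r) :=
    fun r hr => iSup₂_le fun μ hμ => by
      rw [ENNReal.ofReal_div_of_pos hr]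
      calc μ {x | r < ‖x‖} ≤ μ {x | ENNReal.ofReal r ≤ ‖x‖ₑ} := measure_mono fun x hx => by
            rw [Set.mem_ofPred_eq, ← ofReal_norm]
            exact ENNReal.ofReal_le_ofReal (le_of_lt hx)
        _ ≤ (∫⁻ x, ‖x‖ₑ ∂μ) / ENNReal.ofReal r :=
            meas_ge_le_lintegral_div (by fun_prop) (ENNReal.ofReal_pos.2 hr).ne'
              ENNReal.ofReal_ne_top
        _ ≤ ENNReal.ofReal C / ENNReal.ofReal r := by
            rw [← ofReal_integral_norm_eq_lintegral_enorm (hint μ hμ)]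
            gcongr
            exact hC μ hμ
  have hlim : Tendsto (fun r : ℝ => ENNReal.ofReal (C / r)) atTop (𝓝 0) := by
    simpa using ENNReal.tendsto_ofReal (tendsto_const_nhds (x := C).div_atTop tendsto_id)
  exact tendsto_of_tendsto_of_tendsto_of_le_of_le' tendsto_const_nhds hlim
    (Eventually.of_forall fun _ => zero_le) ((eventually_gt_atTop 0).mono hmarkov)

section WeakLimit

variable {μ : ℕ → ProbabilityMeasure ℝ} {ν : ProbabilityMeasure ℝ}

theorem ae_mem_of_tendsto_probabilityMeasure (hlim : Tendsto μ atTop (𝓝 ν)) {s : Set ℝ}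
    (hs : IsClosed s) (h : ∀ n, ∀ᵐ x ∂(μ n : Measure ℝ), x ∈ s) :
    ∀ᵐ x ∂(ν : Measure ℝ), x ∈ s := by
  have hopen := ProbabilityMeasure.le_liminf_measure_open_of_tendsto hlim hs.isOpen_compl
  have hzero : ∀ n, (μ n : Measure ℝ) sᶜ = 0 := h
  simp only [hzero, liminf_const, nonpos_iff_eq_zero] at hopen
  exact hopen

theorem integrable_id_of_tendsto_probabilityMeasure (hlim : Tendsto μ atTop (𝓝 ν)) {C : ℝ}
    (hint : ∀ n, Integrable (fun x => x) (μ n : Measure ℝ))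
    (hC : ∀ n, ∫ x, |x| ∂(μ n : Measure ℝ) ≤ C) : Integrable (fun x => x) (ν : Measure ℝ) := by
  have hfatou := lintegral_le_liminf_lintegral_of_forall_isOpen_measure_le_liminf_measure
    continuous_abs abs_nonneg
    fun G hG => ProbabilityMeasure.le_liminf_measure_open_of_tendsto hlim hG
  have hbound : ∀ n, ∫⁻ x, ENNReal.ofReal |x| ∂(μ n : Measure ℝ) ≤ ENNReal.ofReal C := fun n => by
    rw [← ofReal_integral_eq_lintegral_ofReal (hint n).abs (ae_of_all _ abs_nonneg)]
    exact ENNReal.ofReal_le_ofReal (hC n)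
  refine ⟨by fun_prop, ?_⟩
  rw [hasFiniteIntegral_iff_norm]
  exact (hfatou.trans (liminf_le_of_le (by isBoundedDefault) fun b hb =>
    (hb.exists.choose_spec).trans (hbound _))).trans_lt ENNReal.ofReal_lt_top

end WeakLimit

theorem exists_measure_of_tendsto_integral_inv_ofReal_sub {μ : ℕ → Measure ℝ}
    (hμ : ∀ n, IsProbabilityMeasure (μ n)) {s : Set ℝ} (hs : IsClosed s)
    (hmem : ∀ n, ∀ᵐ x ∂μ n, x ∈ s) {C : ℝ} (hint : ∀ n, Integrable (fun x => x) (μ n))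
    (hC : ∀ n, ∫ x, |x| ∂μ n ≤ C) {g : ℂ → ℂ}
    (hg : ∀ z : ℂ, 0 < z.im →
      Tendsto (fun n => ∫ x : ℝ, ((x : ℂ) - z)⁻¹ ∂μ n) atTop (𝓝 (g z))) :
    ∃ ν : Measure ℝ, IsProbabilityMeasure ν ∧ (∀ᵐ x ∂ν, x ∈ s) ∧ Integrable (fun x => x) ν ∧
      ∀ z : ℂ, 0 < z.im → ∫ x : ℝ, ((x : ℂ) - z)⁻¹ ∂ν = g z := by
  set P : ℕ → ProbabilityMeasure ℝ := fun n => ⟨μ n, hμ n⟩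
  have htight : IsTightMeasureSet {((ν : ProbabilityMeasure ℝ) : Measure ℝ) | ν ∈ Set.range P} :=
    isTightMeasureSet_of_integral_abs_le (by rintro _ ⟨_, ⟨n, rfl⟩, rfl⟩; exact hint n)
      (by rintro _ ⟨_, ⟨n, rfl⟩, rfl⟩; exact hC n)
  obtain ⟨ν, -, φ, hφ, hlim⟩ := (isCompact_closure_of_isTightMeasureSet htight).tendsto_subseq
    fun n => subset_closure (Set.mem_range_self n)
  refine ⟨ν, inferInstance, ae_mem_of_tendsto_probabilityMeasure hlim hs fun n => hmem (φ n),
    integrable_id_of_tendsto_probabilityMeasure hlim (fun n => hint (φ n)) fun n => hC (φ n),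
    fun z hz => ?_⟩
  have hweak := (ProbabilityMeasure.tendsto_iff_forall_integral_rclike_tendsto ℂ).1 hlim
    (BoundedContinuousFunction.ofNormedAddCommGroup (fun x : ℝ => ((x : ℂ) - z)⁻¹)
      (continuous_inv_ofReal_sub hz.ne') _ (norm_inv_ofReal_sub_le hz.ne'))
  exact tendsto_nhds_unique hweak ((hg z hz).comp hφ.tendsto_atTop)

theorem norm_neg_mul_mul_inv_ofReal_sub_le {y : ℝ} (hy : 0 < y) (x : ℝ) :
    ‖-(y * Complex.I) * ((x : ℂ) * ((x : ℂ) - y * Complex.I)⁻¹)‖ ≤ |x| := by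
  have hinv := norm_inv_ofReal_sub_le (z := y * Complex.I) (by simpa using hy.ne') x
  simp only [Complex.im_ofReal_mul, Complex.I_im, mul_one, abs_of_pos hy] at hinv
  calc ‖-((y : ℂ) * Complex.I) * ((x : ℂ) * ((x : ℂ) - y * Complex.I)⁻¹)‖
      = y * (|x| * ‖((x : ℂ) - y * Complex.I)⁻¹‖) := by
        simp only [norm_mul, norm_neg, Complex.norm_real, Complex.norm_I, mul_one,
          Real.norm_eq_abs, abs_of_pos hy]
    _ ≤ y * (|x| * y⁻¹) := by gcongr
    _ = |x| := by field_simp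

theorem tendsto_neg_mul_mul_inv_ofReal_sub (x : ℝ) :
    Tendsto (fun y : ℝ => -(y * Complex.I) * ((x : ℂ) * ((x : ℂ) - y * Complex.I)⁻¹)) atTop
      (𝓝 (x : ℂ)) := by
  have hlim : Tendsto (fun y : ℝ => x * (1 + ((x / y : ℝ) : ℂ) * Complex.I)⁻¹) atTop
      (𝓝 (x * (1 + ((0 : ℝ) : ℂ) * Complex.I)⁻¹)) :=
    tendsto_const_nhds.mul ((tendsto_const_nhds.add (((Complex.continuous_ofReal.tendsto 0).comp
      (tendsto_const_nhds.div_atTop tendsto_id)).mul_const _)).inv₀ (by simp))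
  rw [Complex.ofReal_zero, zero_mul, add_zero, inv_one, mul_one] at hlim
  refine hlim.congr' ?_
  filter_upwards [eventually_gt_atTop 0] with y hy
  have hfactor : (x : ℂ) - y * Complex.I =
      -(y * Complex.I) * (1 + ((x / y : ℝ) : ℂ) * Complex.I) := by
    have : (y : ℂ) ≠ 0 := Complex.ofReal_ne_zero.2 hy.ne'
    push_cast
    field_simp
    linear_combination (x : ℂ) * Complex.I_sq
  rw [hfactor, mul_inv, mul_left_comm, mul_inv_cancel_left₀]
  simpa using hy.ne'

section FiniteMeasure

variable {ν : Measure ℝ} [IsFiniteMeasure ν] {z : ℂ}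

theorem mul_inv_ofReal_sub (hz : z.im ≠ 0) (x : ℝ) :
    (x : ℂ) * ((x : ℂ) - z)⁻¹ = z * ((x : ℂ) - z)⁻¹ + 1 := by
  have := ofReal_sub_ne_zero hz x
  field_simp
  ring

theorem mul_integral_inv_ofReal_sub (hz : z.im ≠ 0) :
    z * ∫ x : ℝ, ((x : ℂ) - z)⁻¹ ∂ν = ∫ x : ℝ, (x : ℂ) * ((x : ℂ) - z)⁻¹ ∂ν - ν.real Set.univ := by
  simp only [mul_inv_ofReal_sub hz]
  rw [integral_add ((integrable_inv_ofReal_sub hz ν).const_mul z) (integrable_const 1),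
    integral_const_mul, integral_const, Complex.real_smul, mul_one, add_sub_cancel_right]

/-- On the imaginary axis `-z (ν(ℝ) + z ∫ dν(x) / (x - z)) = ∫ (-z / (x - z)) x dν(x)`, whose
integrand is dominated by `|x|`. -/
theorem tendsto_neg_mul_integral_inv_ofReal_sub (hint : Integrable (fun x => x) ν) :
    Tendsto (fun y : ℝ => -(y * Complex.I) * (ν.real Set.univ +
      y * Complex.I * ∫ x : ℝ, ((x : ℂ) - y * Complex.I)⁻¹ ∂ν)) atTop
      (𝓝 ((∫ x, x ∂ν : ℝ) : ℂ)) := by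
  have hrewrite : ∀ᶠ y : ℝ in atTop,
      ∫ x : ℝ, -(y * Complex.I) * ((x : ℂ) * ((x : ℂ) - y * Complex.I)⁻¹) ∂ν =
        -(y * Complex.I) * (ν.real Set.univ +
          y * Complex.I * ∫ x : ℝ, ((x : ℂ) - y * Complex.I)⁻¹ ∂ν) := by
    filter_upwards [eventually_gt_atTop 0] with y hy
    rw [mul_integral_inv_ofReal_sub (by simpa using hy.ne'), add_sub_cancel, integral_const_mul]
  rw [← integral_complex_ofReal]
  refine Tendsto.congr' hrewrite (tendsto_integral_filter_of_dominated_convergence (fun x => |x|)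
    (Eventually.of_forall fun y => by fun_prop) ?_ hint.abs (ae_of_all _ fun x => ?_))
  · filter_upwards [eventually_gt_atTop 0] with y hy
    exact ae_of_all _ fun x => norm_neg_mul_mul_inv_ofReal_sub_le hy x
  · exact tendsto_neg_mul_mul_inv_ofReal_sub x

theorem im_mul_integral_inv_ofReal_sub_pos (h0 : ∀ᵐ x ∂ν, 0 ≤ x)
    (hint : Integrable (fun x => x) ν) (hmean : 0 < ∫ x, x ∂ν) (hz : 0 < z.im) :
    0 < (z * ∫ x : ℝ, ((x : ℂ) - z)⁻¹ ∂ν).im := by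
  have hker : Integrable (fun x : ℝ => z * ((x : ℂ) - z)⁻¹) ν :=
    (integrable_inv_ofReal_sub hz.ne' ν).const_mul z
  have him : ∀ x : ℝ, (z * ((x : ℂ) - z)⁻¹).im = x * (z.im / Complex.normSq (x - z)) := fun x => by
    rw [← inv_ofReal_sub_im, ← Complex.im_ofReal_mul, mul_inv_ofReal_sub hz.ne', Complex.add_im,
      Complex.one_im, add_zero]
  have hpos : ∀ x : ℝ, 0 < z.im / Complex.normSq (x - z) := fun x =>
    div_pos hz (Complex.normSq_pos.2 (ofReal_sub_ne_zero hz.ne' x))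
  have hintegral : (z * ∫ x : ℝ, ((x : ℂ) - z)⁻¹ ∂ν).im =
      ∫ x : ℝ, x * (z.im / Complex.normSq (x - z)) ∂ν := by
    rw [← integral_const_mul]
    exact (integral_im hker).symm.trans (integral_congr_ae (ae_of_all _ him))
  rw [hintegral]
  rw [integral_pos_iff_support_of_nonneg_ae h0 hint] at hmean
  rw [integral_pos_iff_support_of_nonneg_ae (h0.mono fun x hx => mul_nonneg hx (hpos x).le)
    (hker.im.congr (ae_of_all _ him))]
  convert hmean using 2
  ext x
  rw [Function.mem_support, Function.mem_support, mul_ne_zero_iff]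
  exact and_iff_left (hpos x).ne'

theorem div_le_inv_ofReal_sub_im {K : ℝ} (hK : 0 < K) (hz : 0 < z.im) {x : ℝ} (hx : 0 ≤ x) :
    z.im / (2 * (K ^ 2 + ‖z‖ ^ 2)) * (1 - x / K) ≤ (((x : ℂ) - z)⁻¹).im := by
  rw [inv_ofReal_sub_im]
  have hpos : 0 < Complex.normSq (x - z) := Complex.normSq_pos.2 (ofReal_sub_ne_zero hz.ne' x)
  rcases le_or_gt x K with hxK | hxK
  · have hnorm : Complex.normSq (x - z) ≤ 2 * (K ^ 2 + ‖z‖ ^ 2) := by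
      rw [Complex.normSq_eq_norm_sq]
      have := norm_sub_le (x : ℂ) z
      rw [Complex.norm_real, Real.norm_of_nonneg hx] at this
      nlinarith [sq_nonneg (K - ‖z‖), norm_nonneg ((x : ℂ) - z), norm_nonneg z]
    calc z.im / (2 * (K ^ 2 + ‖z‖ ^ 2)) * (1 - x / K)
        ≤ z.im / (2 * (K ^ 2 + ‖z‖ ^ 2)) :=
          mul_le_of_le_one_right (by positivity) (sub_le_self _ (by positivity))
      _ ≤ z.im / Complex.normSq (x - z) := by gcongr
  · have hneg : 1 - x / K ≤ 0 := sub_nonpos.2 ((one_le_div hK).2 hxK.le)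
    exact (mul_nonpos_of_nonneg_of_nonpos (by positivity) hneg).trans (by positivity)

theorem div_mul_le_im_integral_inv_ofReal_sub (h0 : ∀ᵐ x ∂ν, 0 ≤ x)
    (hint : Integrable (fun x => x) ν) {K : ℝ} (hK : 0 < K)
    (hmean : 2 * ∫ x, x ∂ν ≤ K * ν.real Set.univ) (hz : 0 < z.im) :
    z.im / (4 * (K ^ 2 + ‖z‖ ^ 2)) * ν.real Set.univ ≤ (∫ x : ℝ, ((x : ℂ) - z)⁻¹ ∂ν).im := by
  obtain ⟨D, hD⟩ : ∃ D, D = K ^ 2 + ‖z‖ ^ 2 := ⟨_, rfl⟩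
  have hD₀ : 0 < D := by rw [hD]; positivity
  rw [← hD]
  have hhalf : ν.real Set.univ / 2 ≤ ν.real Set.univ - (∫ x, x ∂ν) / K := by
    have : (∫ x, x ∂ν) / K ≤ ν.real Set.univ / 2 := by
      rw [div_le_iff₀ hK]
      linarith
    linarith
  calc z.im / (4 * D) * ν.real Set.univ = z.im / (2 * D) * (ν.real Set.univ / 2) := by ring
    _ ≤ z.im / (2 * D) * (ν.real Set.univ - (∫ x, x ∂ν) / K) := by gcongr
    _ = ∫ x : ℝ, z.im / (2 * D) * (1 - x / K) ∂ν := by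
        rw [integral_const_mul, integral_sub (integrable_const _) (hint.div_const K), integral_div,
          integral_const, smul_eq_mul, mul_one]
    _ ≤ ∫ x : ℝ, (((x : ℂ) - z)⁻¹).im ∂ν :=
        integral_mono_ae (((integrable_const _).sub (hint.div_const K)).const_mul _)
          (integrable_inv_ofReal_sub hz.ne' ν).im
          (h0.mono fun x hx => hD ▸ div_le_inv_ofReal_sub_im hK hz hx)
    _ = (∫ x : ℝ, ((x : ℂ) - z)⁻¹ ∂ν).im := integral_im (integrable_inv_ofReal_sub hz.ne' ν)

end FiniteMeasure

theorem exists_sq_eq_of_im_pos {z : ℂ} (hz : 0 < z.im) : ∃ u : ℂ, 0 < u.im ∧ u ^ 2 = z := by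
  obtain ⟨v, rfl⟩ := IsAlgClosed.exists_pow_nat_eq z two_pos
  have hv : v.im ≠ 0 := fun h0 => by simp [pow_two, h0] at hz
  rcases hv.lt_or_gt with hneg | hpos
  · exact ⟨-v, by simpa using hneg, neg_sq v⟩
  · exact ⟨v, hpos, rfl⟩

theorem eq_of_sq_eq_sq_of_im_pos {u v : ℂ} (hu : 0 < u.im) (hv : 0 < v.im) (h : u ^ 2 = v ^ 2) :
    u = v := by
  refine (sq_eq_sq_iff_eq_or_eq_neg.1 h).resolve_right fun hneg => ?_
  rw [hneg, Complex.neg_im] at hu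
  linarith

theorem re_pos_of_im_pos_of_im_sq_pos {u : ℂ} (hu : 0 < u.im) (hu2 : 0 < (u ^ 2).im) :
    0 < u.re := by
  rw [pow_two, Complex.mul_im] at hu2
  exact pos_of_mul_pos_left (by linarith : 0 < u.re * u.im) hu.le

section Asymptotics

variable {α ι : Type*} [Fintype ι] {a r : ι → ℝ} {c s : ℝ} {l : Filter α} {u h : α → ℂ}

theorem one_add_mul_dressedResolvent {u h : ℂ} (hc : 0 ≤ c) (hs : 0 ≤ s) (hu : 0 < u.im)
    (hh : 0 ≤ h.im) :
    1 + u * dressedResolvent c s u h = -(s * selfEnergy c h * dressedResolvent c s u h) := by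
  have := add_mul_ne_zero_of_im hs hu (selfEnergy_im_nonneg hc hh)
  rw [dressedResolvent]
  field_simp
  ring

theorem tendsto_dressedResolvent_zero (hc : 0 ≤ c) (hs : 0 ≤ s)
    (hu : Tendsto (fun x => (u x).im) l atTop) (hh : ∀ᶠ x in l, 0 < (h x).im) :
    Tendsto (fun x => dressedResolvent c s (u x) (h x)) l (𝓝 0) := by
  have him : Tendsto (fun x => ‖u x + s * selfEnergy c (h x)‖) l atTop := by
    refine tendsto_atTop_mono' l (hh.mono fun x hx => ?_) hu
    calc (u x).im ≤ (u x + s * selfEnergy c (h x)).im := by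
          rw [Complex.add_im, Complex.im_ofReal_mul]
          exact le_add_of_nonneg_right (mul_nonneg hs (selfEnergy_im_nonneg hc hx.le))
      _ ≤ ‖u x + s * selfEnergy c (h x)‖ := Complex.im_le_norm _
  rw [← neg_zero]
  exact (tendsto_inv₀_cobounded.comp (tendsto_norm_atTop_iff_cobounded.1 him)).neg

theorem tendsto_selfEnergy_zero (hh : Tendsto h l (𝓝 0)) :
    Tendsto (fun x => selfEnergy c (h x)) l (𝓝 0) := by
  have := (continuousAt_selfEnergy (c := c) (Or.inr rfl)).tendsto.comp hh
  rwa [selfEnergy_zero] at this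

theorem tendsto_mul_selfEnergy {w : ℂ} (hh : Tendsto h l (𝓝 0))
    (huh : Tendsto (fun x => u x * h x) l (𝓝 w)) :
    Tendsto (fun x => u x * selfEnergy c (h x)) l (𝓝 (c * w)) := by
  have hden : Tendsto (fun x => 1 - (c : ℂ) ^ 2 * h x ^ 2) l (𝓝 1) := by
    simpa using ((hh.pow 2).const_mul ((c : ℂ) ^ 2)).const_sub 1
  have hquot := (huh.const_mul (c : ℂ)).div hden one_ne_zero
  rw [div_one] at hquot
  refine hquot.congr fun x => ?_
  rw [Pi.div_apply, selfEnergy]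
  ring

theorem tendsto_mul_dressedResolvent (hc : 0 ≤ c) (hs : 0 ≤ s)
    (hu : Tendsto (fun x => (u x).im) l atTop) (hh : ∀ᶠ x in l, 0 < (h x).im)
    (hh₀ : Tendsto h l (𝓝 0)) :
    Tendsto (fun x => u x * dressedResolvent c s (u x) (h x)) l (𝓝 (-1)) := by
  have hlim := ((((tendsto_selfEnergy_zero (c := c) hh₀).const_mul (s : ℂ)).mul
    (tendsto_dressedResolvent_zero hc hs hu hh)).neg).sub_const 1
  rw [mul_zero, neg_zero, zero_sub] at hlim
  refine hlim.congr' ?_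
  filter_upwards [hh, hu.eventually_gt_atTop 0] with x hx hux
  rw [← one_add_mul_dressedResolvent hc hs hux hx.le, add_sub_cancel_left]

theorem tendsto_mul_resolventMap (hr : ∀ i, 0 ≤ r i) (hc : 0 ≤ c)
    (hu : Tendsto (fun x => (u x).im) l atTop) (hh : ∀ᶠ x in l, 0 < (h x).im)
    (hh₀ : Tendsto h l (𝓝 0)) :
    Tendsto (fun x => u x * resolventMap a r c (u x) (h x)) l (𝓝 (-(∑ i, a i : ℝ))) := by
  have hsum := tendsto_finsetSum Finset.univ fun i _ =>
    (tendsto_mul_dressedResolvent hc (hr i) hu hh hh₀).const_mul (a i : ℂ)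
  simp only [mul_neg, mul_one, Finset.sum_neg_distrib, ← Complex.ofReal_sum] at hsum
  refine hsum.congr fun x => ?_
  rw [resolventMap, Finset.mul_sum]
  exact Finset.sum_congr rfl fun i _ => mul_left_comm _ _ _

theorem tendsto_zero_of_resolventMap_eq_self (ha : ∀ i, 0 ≤ a i) (hr : ∀ i, 0 ≤ r i) (hc : 0 ≤ c)
    (hu : Tendsto (fun x => (u x).im) l atTop) (hh : ∀ᶠ x in l, 0 < (h x).im)
    (hfix : ∀ᶠ x in l, resolventMap a r c (u x) (h x) = h x) : Tendsto h l (𝓝 0) := by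
  refine squeeze_zero_norm' ?_ (hu.const_div_atTop (∑ i, a i))
  filter_upwards [hh, hfix, hu.eventually_gt_atTop 0] with x hx hfx hux
  have hbound := im_mul_norm_resolventMap_sq_le ha hr hc hux.le hx.le
  rw [hfx] at hbound
  exact norm_le_div_of_im_mul_norm_sq_le hux hx hbound

theorem tendsto_neg_sq_mul_one_add_mul_dressedResolvent (ha : ∀ i, 0 ≤ a i) (hr : ∀ i, 0 ≤ r i)
    (hc : 0 ≤ c) (hs : 0 ≤ s) (hu : Tendsto (fun x => (u x).im) l atTop)
    (hh : ∀ᶠ x in l, 0 < (h x).im) (hfix : ∀ᶠ x in l, resolventMap a r c (u x) (h x) = h x) :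
    Tendsto (fun x => -(u x ^ 2) * (1 + u x * dressedResolvent c s (u x) (h x))) l
      (𝓝 ((c * (∑ i, a i) * s : ℝ) : ℂ)) := by
  have hh₀ := tendsto_zero_of_resolventMap_eq_self ha hr hc hu hh hfix
  have huh : Tendsto (fun x => u x * h x) l (𝓝 (-(∑ i, a i : ℝ))) :=
    (tendsto_mul_resolventMap hr hc hu hh hh₀).congr' (hfix.mono fun x hx => by rw [hx])
  have hlim := ((tendsto_mul_selfEnergy (c := c) hh₀ huh).const_mul (s : ℂ)).mul
    (tendsto_mul_dressedResolvent hc hs hu hh hh₀)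
  have hvalue : (s : ℂ) * (c * -(∑ i, a i : ℝ)) * -1 = ((c * (∑ i, a i) * s : ℝ) : ℂ) := by
    push_cast
    ring
  rw [hvalue] at hlim
  refine hlim.congr' ?_
  filter_upwards [hh, hu.eventually_gt_atTop 0] with x hx hux
  rw [one_add_mul_dressedResolvent hc hs hux hx.le]
  ring

end Asymptotics

section FixedPointMeasure

variable {ι : Type*} [Fintype ι] {a r : ι → ℝ} {c s : ℝ}

theorem integral_eq_of_dressedResolvent_eq_mul_integral (ha : ∀ i, 0 ≤ a i) (hτ : 0 < ∑ i, a i)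
    (hr : ∀ i, 0 ≤ r i) (hc : 0 ≤ c) (hs : 0 ≤ s) {ν : Measure ℝ} [IsProbabilityMeasure ν]
    (hint : Integrable (fun x => x) ν)
    (hν : ∀ u h : ℂ, 0 < u.im → 0 < (u ^ 2).im → 0 < h.im → resolventMap a r c u h = h →
      dressedResolvent c s u h = u * ∫ x : ℝ, ((x : ℂ) - u ^ 2)⁻¹ ∂ν) :
    ∫ x, x ∂ν = c * (∑ i, a i) * s := by
  choose! H hH hfix _ using fun (u : ℂ) (hu : 0 < u.im) =>
    exists_tendsto_iterate_resolventMap (u := u) ha hτ hr hc hu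
  set u : ℝ → ℂ := fun y => (√(y / 2) : ℝ) * (1 + Complex.I)
  have hu_im : ∀ y, (u y).im = √(y / 2) := fun y => by simp [u]
  have hu_sq : ∀ y, 0 < y → u y ^ 2 = y * Complex.I := fun y hy => by
    have hsqrt : ((√(y / 2) : ℝ) : ℂ) ^ 2 = y / 2 := by
      exact_mod_cast Real.sq_sqrt (by positivity : 0 ≤ y / 2)
    rw [mul_pow, hsqrt]
    linear_combination (y / 2 : ℂ) * Complex.I_sq
  have hu : Tendsto (fun y => (u y).im) atTop atTop := by
    simp only [hu_im]
    exact Real.tendsto_sqrt_atTop.comp (tendsto_id.atTop_div_const two_pos)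
  have hu_pos : ∀ᶠ y in atTop, 0 < (u y).im := hu.eventually_gt_atTop 0
  have hlim := tendsto_neg_sq_mul_one_add_mul_dressedResolvent ha hr hc hs hu
    (hu_pos.mono fun y => hH (u y)) (hu_pos.mono fun y => hfix (u y))
  refine Complex.ofReal_injective (tendsto_nhds_unique
    ((tendsto_neg_mul_integral_inv_ofReal_sub hint).congr' ?_) hlim)
  filter_upwards [hu_pos, eventually_gt_atTop 0] with y huy hy
  have hsq_im : 0 < (u y ^ 2).im := by simpa [hu_sq y hy] using hy
  rw [hν _ _ huy hsq_im (hH _ huy) (hfix _ huy), ← mul_assoc, ← pow_two, hu_sq y hy,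
    probReal_univ, Complex.ofReal_one]

theorem exists_measure_iterate_resolventMap (ha : ∀ i, 0 ≤ a i) (hr : ∀ i, 0 ≤ r i) (hc : 0 ≤ c)
    (hs : 0 ≤ s) (n : ℕ) :
    ∃ ν : Measure ℝ, IsProbabilityMeasure ν ∧ (∀ᵐ x ∂ν, 0 ≤ x) ∧ Integrable (fun x => x) ν ∧
      ∫ x, |x| ∂ν = s * (c * ∑ i, a i) ∧ ∀ u : ℂ, u.im ≠ 0 → (u ^ 2).im ≠ 0 →
        dressedResolvent c s u ((resolventMap a r c u)^[n + 1] 0) =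
          u * ∫ x : ℝ, ((x : ℂ) - u ^ 2)⁻¹ ∂ν := by
  obtain ⟨κ, hκ⟩ := exists_isAtomicStieltjes_iterate_resolventMap ha hr hc n
  obtain ⟨ν, _, hone, h0, hint, hmean, hν⟩ := (hκ.dressedResolvent_comp hc hs).exists_measure_of_odd
    fun u => by rw [iterate_resolventMap_neg, dressedResolvent_neg]
  refine ⟨ν, ⟨?_⟩, h0, hint, ?_, hν⟩
  · rw [← ofReal_measureReal, hone, ENNReal.ofReal_one]
  · rw [integral_congr_ae (h0.mono fun x hx => abs_of_nonneg hx), hmean]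

theorem exists_measure_dressedResolvent (ha : ∀ i, 0 ≤ a i) (hτ : 0 < ∑ i, a i)
    (hr : ∀ i, 0 ≤ r i) (hc : 0 ≤ c) (hs : 0 ≤ s) :
    ∃ ν : Measure ℝ, IsProbabilityMeasure ν ∧ (∀ᵐ x ∂ν, 0 ≤ x) ∧ Integrable (fun x => x) ν ∧
      ∫ x, x ∂ν = c * (∑ i, a i) * s ∧ ∀ u h : ℂ, 0 < u.im → 0 < (u ^ 2).im → 0 < h.im →
        resolventMap a r c u h = h →
          dressedResolvent c s u h = u * ∫ x : ℝ, ((x : ℂ) - u ^ 2)⁻¹ ∂ν := by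
  choose μ hprob h0 hint habs hμ using exists_measure_iterate_resolventMap ha hr hc hs
  choose! H hH hfix hlim using fun (u : ℂ) (hu : 0 < u.im) =>
    exists_tendsto_iterate_resolventMap (u := u) ha hτ hr hc hu
  choose! root hroot_im hroot_sq using fun (z : ℂ) (hz : 0 < z.im) => exists_sq_eq_of_im_pos hz
  obtain ⟨ν, hν_prob, hν0, hν_int, hν⟩ := exists_measure_of_tendsto_integral_inv_ofReal_sub hprob
    isClosed_Ici h0 hint (fun n => (habs n).le)
    (g := fun z => (root z)⁻¹ * dressedResolvent c s (root z) (H (root z))) fun z hz => by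
      have hv := hroot_im z hz
      refine (((continuousAt_dressedResolvent hc hs hv (Or.inl (hH _ hv))).tendsto.comp
        (hlim _ hv)).const_mul (root z)⁻¹).congr fun n => ?_
      rw [Function.comp_apply, hμ n _ hv.ne' (by rw [hroot_sq z hz]; exact hz.ne'), hroot_sq z hz,
        inv_mul_cancel_left₀ (ne_zero_of_im_pos hv)]
  have hres : ∀ u h : ℂ, 0 < u.im → 0 < (u ^ 2).im → 0 < h.im → resolventMap a r c u h = h →
      dressedResolvent c s u h = u * ∫ x : ℝ, ((x : ℂ) - u ^ 2)⁻¹ ∂ν := by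
    intro u h hu hu2 hh hhfix
    rw [hν _ hu2, eq_of_sq_eq_sq_of_im_pos (hroot_im _ hu2) hu (hroot_sq _ hu2),
      mul_inv_cancel_left₀ (ne_zero_of_im_pos hu),
      eq_of_resolventMap_eq_self ha hτ hr hc hu hh (hH u hu) hhfix (hfix u hu)]
  exact ⟨ν, hν_prob, hν0, hν_int,
    integral_eq_of_dressedResolvent_eq_mul_integral ha hτ hr hc hs hν_int hres, hres⟩

end FixedPointMeasure

section SMulConstMeasure

variable {α E F G : Type*} [MeasurableSpace α] {ν : Measure α} [IsFiniteMeasure ν]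

/-- The vector measure `S ↦ ν(S) • v` with constant direction `v`. The values are only required to
lie in a topological vector space, since `Matrix` carries no canonical norm. -/
noncomputable def smulConstMeasure [AddCommGroup E] [Module ℝ E] [TopologicalSpace E]
    [ContinuousSMul ℝ E] (ν : Measure α) [IsFiniteMeasure ν] (v : E) : VectorMeasure α E :=
  ν.toSignedMeasure.mapRange (LinearMap.toSpanSingleton ℝ E v).toAddMonoidHom
    (continuous_id.smul continuous_const)

theorem smulConstMeasure_apply [AddCommGroup E] [Module ℝ E] [TopologicalSpace E]
    [ContinuousSMul ℝ E] (v : E) {S : Set α} (hS : MeasurableSet S) :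
    smulConstMeasure ν v S = ν.real S • v := by
  change ν.toSignedMeasure S • v = _
  rw [Measure.toSignedMeasure_apply_measurable hS]

variable [NormedAddCommGroup E] [NormedAddCommGroup F] [NormedSpace ℝ F]

theorem variation_smulConstMeasure_le (v : F) : (smulConstMeasure ν v).variation ≤ ‖v‖ₑ • ν := by
  refine VectorMeasure.variation_le_of_forall_enorm_le fun S hS => ?_
  rw [smulConstMeasure_apply v hS, enorm_smul, Measure.smul_apply, smul_eq_mul, mul_comm,
    Real.enorm_of_nonneg measureReal_nonneg, ofReal_measureReal]

theorem integrable_smulConstMeasure (v : F) {f : α → E} (hf : Integrable f ν) :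
    (smulConstMeasure ν v).Integrable f :=
  (hf.smul_measure (c := ‖v‖ₑ) enorm_ne_top).mono_measure (variation_smulConstMeasure_le v)

variable [NormedSpace ℝ E] [CompleteSpace E] [NormedAddCommGroup G] [NormedSpace ℝ G]
  [CompleteSpace G]

theorem integral_smulConstMeasure (B : E →L[ℝ] F →L[ℝ] G) (v : F) {f : α → E}
    (hf : Integrable f ν) :
    (smulConstMeasure ν v).integral f B = B (∫ x, f x ∂ν) v := by
  have hT : DominatedFinMeasAdditive ν ((smulConstMeasure ν v).transpose B) (‖B‖ * ‖v‖) := by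
    refine ⟨fun s t hs ht _ _ hd => cbmApplyMeasure_union _ B hs ht hd,
      fun s hs _ => (norm_cbmApplyMeasure_le _ _ _).trans_eq ?_⟩
    rw [smulConstMeasure_apply v hs, norm_smul, Real.norm_of_nonneg measureReal_nonneg]
    ring
  have hset : (smulConstMeasure ν v).integral f B =
      setToFun ν ((smulConstMeasure ν v).transpose B) hT f := by
    rw [VectorMeasure.integral_eq_setToFun]
    exact (setToFun_congr_measure_of_integrable _ enorm_ne_top (variation_smulConstMeasure_le v)
      _ _ f hf).symm
  rw [hset]
  refine Integrable.induction
    (fun f => setToFun ν ((smulConstMeasure ν v).transpose B) hT f = B (∫ x, f x ∂ν) v)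
    (fun e s hs hνs => ?_) (fun f g _ hf hg hf' hg' => ?_) ?_ (fun f g hfg _ hf' => ?_) hf
  · rw [setToFun_indicator_const hT hs hνs.ne, integral_indicator_const e hs, map_smul,
      smul_apply, ← map_smul, ← smulConstMeasure_apply v hs]
    rfl
  · rw [setToFun_add hT hf hg, hf', hg', ← add_apply, ← map_add,
      ← integral_add hf hg]
    rfl
  · exact isClosed_eq (continuous_setToFun hT) ((B.flip v).continuous.comp continuous_integral)
  · rw [← setToFun_congr_ae hT hfg, hf', integral_congr_ae hfg]

end SMulConstMeasure

section ConjDiagonal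

variable {n : Type*} [Fintype n] [DecidableEq n] (U : Matrix.unitaryGroup n ℂ)

/-- The algebra homomorphism `d ↦ U diag(d) Uᴴ`, through which every computation with functions of
a Hermitian matrix with eigenvector matrix `U` reduces to its eigenvalues. -/
noncomputable def conjDiagonal : (n → ℂ) →ₐ[ℂ] Matrix n n ℂ :=
  (Unitary.conjStarAlgAut ℂ (Matrix n n ℂ) U : Matrix n n ℂ →ₐ[ℂ] Matrix n n ℂ).comp
    (Matrix.diagonalAlgHom ℂ)

theorem conjDiagonal_apply (d : n → ℂ) :
    conjDiagonal U d = (U : Matrix n n ℂ) * Matrix.diagonal d * star (U : Matrix n n ℂ) := rfl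

theorem trace_conjDiagonal (d : n → ℂ) : (conjDiagonal U d).trace = ∑ i, d i := by
  rw [conjDiagonal_apply, Matrix.trace_mul_comm, ← mul_assoc, Unitary.coe_star_mul_self, one_mul,
    Matrix.trace_diagonal]

theorem posSemidef_conjDiagonal_iff (d : n → ℂ) :
    (conjDiagonal U d).PosSemidef ↔ ∀ i, 0 ≤ d i := by
  rw [conjDiagonal_apply, Matrix.IsUnit.posSemidef_star_right_conjugate_iff
    (Unitary.isUnit_coe (U := U)), Matrix.posSemidef_diagonal_iff]

theorem conjDiagonal_eq_sum_smul (d : n → ℂ) :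
    conjDiagonal U d = ∑ i, d i • conjDiagonal U (Pi.single i 1) := by
  conv_lhs => rw [pi_eq_sum_univ' d]
  simp only [map_sum, map_smul]

theorem isUnit_conjDiagonal {d : n → ℂ} (hd : ∀ i, d i ≠ 0) : IsUnit (conjDiagonal U d) :=
  (Pi.isUnit_iff.2 fun i => (hd i).isUnit).map (conjDiagonal U)

theorem inv_conjDiagonal {d : n → ℂ} (hd : ∀ i, d i ≠ 0) :
    (conjDiagonal U d)⁻¹ = conjDiagonal U fun i => (d i)⁻¹ := by
  refine Matrix.inv_eq_right_inv ?_
  rw [← map_mul, ← map_one (conjDiagonal U)]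
  exact congrArg _ (funext fun i => mul_inv_cancel₀ (hd i))

theorem eq_conjDiagonal_eigenvalues {R : Matrix n n ℂ} (hR : R.IsHermitian) :
    R = conjDiagonal hR.eigenvectorUnitary (fun i => (hR.eigenvalues i : ℂ)) :=
  hR.spectral_theorem

theorem eigenvalues_le {R : Matrix n n ℂ} (hR : R.IsHermitian) {b : ℝ}
    (hRb : ((b : ℂ) • (1 : Matrix n n ℂ) - R).PosSemidef) (i : n) : hR.eigenvalues i ≤ b := by
  have h : (b : ℂ) • (1 : Matrix n n ℂ) - R =
      conjDiagonal hR.eigenvectorUnitary (fun i => ((b - hR.eigenvalues i : ℝ) : ℂ)) := by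
    conv_lhs => rw [eq_conjDiagonal_eigenvalues hR, ← map_one (conjDiagonal hR.eigenvectorUnitary),
      ← map_smul, ← map_sub]
    congr 1
    ext i
    simp only [Pi.sub_apply, Pi.smul_apply, Pi.one_apply, smul_eq_mul, mul_one, Complex.ofReal_sub]
  rw [h, posSemidef_conjDiagonal_iff] at hRb
  exact sub_nonneg.1 (Complex.zero_le_real.1 (hRb i))

end ConjDiagonal

section ConjDiagonalMeasure

variable {m : ℕ} (U : Matrix.unitaryGroup (Fin m) ℂ) (ν : Fin m → Measure ℝ)
  [∀ i, IsFiniteMeasure (ν i)]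

/-- The matrix-valued measure `U diag(ν i) Uᴴ`. -/
noncomputable def conjDiagonalMeasure : VectorMeasure ℝ (Matrix (Fin m) (Fin m) ℂ) :=
  ∑ i, smulConstMeasure (ν i) (conjDiagonal U (Pi.single i 1))

variable {ν}

theorem conjDiagonalMeasure_apply {S : Set ℝ} (hS : MeasurableSet S) :
    conjDiagonalMeasure U ν S = conjDiagonal U fun i => ((ν i).real S : ℂ) := by
  rw [conjDiagonalMeasure, FunLike.coe_sum, Finset.sum_apply, conjDiagonal_eq_sum_smul]
  exact Finset.sum_congr rfl fun i _ => smulConstMeasure_apply _ hS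

theorem entryMeasure_conjDiagonalMeasure (j k : Fin m) :
    entryMeasure (conjDiagonalMeasure U ν) j k =
      ∑ i, smulConstMeasure (ν i) (conjDiagonal U (Pi.single i 1) j k) := by
  ext S hS
  rw [entryMeasure_apply, conjDiagonalMeasure, FunLike.coe_sum, FunLike.coe_sum, Finset.sum_apply,
    Finset.sum_apply, Matrix.sum_apply]
  refine Finset.sum_congr rfl fun i _ => ?_
  rw [smulConstMeasure_apply _ hS, smulConstMeasure_apply _ hS, Matrix.smul_apply]

theorem integral_entryMeasure_conjDiagonalMeasure {f : ℝ → ℂ} (hf : ∀ i, Integrable f (ν i))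
    (j k : Fin m) :
    (entryMeasure (conjDiagonalMeasure U ν) j k).integral f (ContinuousLinearMap.mul ℝ ℂ) =
      conjDiagonal U (fun i => ∫ x, f x ∂ν i) j k := by
  rw [entryMeasure_conjDiagonalMeasure, VectorMeasure.integral_finsetSum_vectorMeasure
    fun i _ => integrable_smulConstMeasure _ (hf i), conjDiagonal_eq_sum_smul, Matrix.sum_apply]
  exact Finset.sum_congr rfl fun i _ => integral_smulConstMeasure _ _ (hf i)

theorem isMatrixStieltjesTransform_conjDiagonalMeasure {A : Set ℝ} (hA : MeasurableSet A)
    (hν : ∀ i, ν i Aᶜ = 0) {F : ℂ → Matrix (Fin m) (Fin m) ℂ}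
    (hF : ∀ z : ℂ, 0 < z.im → F z = conjDiagonal U fun i => ∫ x : ℝ, ((x : ℂ) - z)⁻¹ ∂ν i) :
    IsMatrixStieltjesTransform A (conjDiagonalMeasure U ν) F := by
  refine ⟨fun S hS => ?_, ?_, fun z hz j k => ?_⟩
  · rw [conjDiagonalMeasure_apply U hS, posSemidef_conjDiagonal_iff]
    exact fun i => Complex.zero_le_real.2 measureReal_nonneg
  · rw [conjDiagonalMeasure_apply U hA.compl]
    simp only [Measure.real, hν, ENNReal.toReal_zero, Complex.ofReal_zero]
    exact map_zero _
  · rw [hF z hz, integral_entryMeasure_conjDiagonalMeasure U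
      fun i => integrable_inv_ofReal_sub hz.ne' (ν i)]

end ConjDiagonalMeasure

section ResolventFamily

variable {ι : Type*} [Fintype ι] {a r : ι → ℝ} {c : ℝ} {ν : ι → Measure ℝ} {u h z : ℂ}

/-- The `ν i` represent the resolvents at a fixed point `h` of `resolventMap a r c u`: they are the
spectral measures of the deterministic equivalent in the eigendirections of `R`, expressed in the
variable `z = u ^ 2`. -/
structure IsResolventFamily (a r : ι → ℝ) (c : ℝ) (ν : ι → Measure ℝ) : Prop where
  isProbabilityMeasure : ∀ i, IsProbabilityMeasure (ν i)
  ae_nonneg : ∀ i, ∀ᵐ x ∂ν i, 0 ≤ x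
  integrable_id : ∀ i, Integrable (fun x => x) (ν i)
  integral_id : ∀ i, ∫ x, x ∂ν i = c * (∑ j, a j) * r i
  dressedResolvent_eq : ∀ i (u h : ℂ), 0 < u.im → 0 < (u ^ 2).im → 0 < h.im →
    resolventMap a r c u h = h →
      dressedResolvent c (r i) u h = u * ∫ x : ℝ, ((x : ℂ) - u ^ 2)⁻¹ ∂ν i

theorem exists_isResolventFamily (ha : ∀ i, 0 ≤ a i) (hτ : 0 < ∑ i, a i) (hr : ∀ i, 0 ≤ r i)
    (hc : 0 ≤ c) : ∃ ν : ι → Measure ℝ, IsResolventFamily a r c ν := by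
  choose ν hprob h0 hint hmean hres using fun i =>
    exists_measure_dressedResolvent ha hτ hr hc (hr i)
  exact ⟨ν, hprob, h0, hint, hmean, hres⟩

namespace IsResolventFamily

theorem real_Ici_zero (hν : IsResolventFamily a r c ν) (i : ι) :
    (ν i).real (Set.Ici 0) = 1 := by
  have := hν.isProbabilityMeasure i
  rw [measureReal_def, (mem_ae_iff_prob_eq_one measurableSet_Ici).1 (hν.ae_nonneg i),
    ENNReal.toReal_one]

theorem integral_weightedMeasure_id (hν : IsResolventFamily a r c ν) (ha : ∀ i, 0 ≤ a i) :
    ∫ x, x ∂weightedMeasure a ν = c * (∑ i, a i) * ∑ i, a i * r i := by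
  rw [integral_weightedMeasure ha hν.integrable_id, Finset.mul_sum]
  exact Finset.sum_congr rfl fun i _ => by rw [hν.integral_id, smul_eq_mul]; ring

theorem weightedMeasure_real_univ (hν : IsResolventFamily a r c ν) (ha : ∀ i, 0 ≤ a i) :
    (weightedMeasure a ν).real Set.univ = ∑ i, a i := by
  have := hν.isProbabilityMeasure
  simp only [weightedMeasure_real_apply ha, probReal_univ, mul_one]

theorem eq_mul_integral (hν : IsResolventFamily a r c ν) (ha : ∀ i, 0 ≤ a i) (hu : 0 < u.im)
    (hu2 : 0 < (u ^ 2).im) (hh : 0 < h.im) (hfix : resolventMap a r c u h = h) :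
    h = u * ∫ x : ℝ, ((x : ℂ) - u ^ 2)⁻¹ ∂weightedMeasure a ν := by
  have := hν.isProbabilityMeasure
  conv_lhs => rw [← hfix, resolventMap]
  rw [integral_weightedMeasure ha fun i => integrable_inv_ofReal_sub hu2.ne' (ν i), Finset.mul_sum]
  exact Finset.sum_congr rfl fun i _ => by
    rw [hν.dressedResolvent_eq i u h hu hu2 hh hfix, Complex.real_smul, mul_left_comm]

theorem sum_mul_div_le_im_integral (hν : IsResolventFamily a r c ν) (ha : ∀ i, 0 ≤ a i) {K : ℝ}
    (hK : 0 < K) (hrK : 2 * (c * ∑ i, a i * r i) ≤ K) (hz : 0 < z.im) :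
    z.im / (4 * (K ^ 2 + ‖z‖ ^ 2)) * ∑ i, a i ≤
      (∫ x : ℝ, ((x : ℂ) - z)⁻¹ ∂weightedMeasure a ν).im := by
  have := hν.isProbabilityMeasure
  rw [← hν.weightedMeasure_real_univ ha]
  refine div_mul_le_im_integral_inv_ofReal_sub (ae_weightedMeasure hν.ae_nonneg)
    (integrable_weightedMeasure hν.integrable_id) hK ?_ hz
  rw [hν.integral_weightedMeasure_id ha, hν.weightedMeasure_real_univ ha]
  calc 2 * ((c * ∑ i, a i) * ∑ i, a i * r i) = 2 * (c * ∑ i, a i * r i) * ∑ i, a i := by ring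
    _ ≤ K * ∑ i, a i := mul_le_mul_of_nonneg_right hrK (Finset.sum_nonneg fun i _ => ha i)

theorem im_integral_pos (hν : IsResolventFamily a r c ν) (ha : ∀ i, 0 ≤ a i) (hτ : 0 < ∑ i, a i)
    (hz : 0 < z.im) : 0 < (∫ x : ℝ, ((x : ℂ) - z)⁻¹ ∂weightedMeasure a ν).im := by
  refine lt_of_lt_of_le ?_ (hν.sum_mul_div_le_im_integral ha
    (K := |2 * (c * ∑ i, a i * r i)| + 1) (by positivity)
    ((le_abs_self _).trans (le_add_of_nonneg_right zero_le_one)) hz)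
  positivity

theorem im_mul_integral_pos (hν : IsResolventFamily a r c ν) (ha : ∀ i, 0 ≤ a i)
    (hτ : 0 < ∑ i, a i) (har : 0 < ∑ i, a i * r i) (hc : 0 < c) (hz : 0 < z.im) :
    0 < (z * ∫ x : ℝ, ((x : ℂ) - z)⁻¹ ∂weightedMeasure a ν).im := by
  have := hν.isProbabilityMeasure
  refine im_mul_integral_inv_ofReal_sub_pos (ae_weightedMeasure hν.ae_nonneg)
    (integrable_weightedMeasure hν.integrable_id) ?_ hz
  rw [hν.integral_weightedMeasure_id ha]
  positivity

end IsResolventFamily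

end ResolventFamily

theorem matrix_inv_neg {n R : Type*} [Fintype n] [DecidableEq n] [CommRing R] (A : Matrix n n R) :
    (-A)⁻¹ = -A⁻¹ := by
  have hinv : (-1 : Matrix n n R)⁻¹ = -1 := Matrix.inv_eq_right_inv (by rw [neg_mul_neg, one_mul])
  rw [← neg_one_mul, Matrix.mul_inv_rev, hinv, mul_neg_one]

section CanonicalEquation

variable {m : ℕ} (U : Matrix.unitaryGroup (Fin m) ℂ) {l : Fin m → ℝ} {c : ℝ} {u t : ℂ}

theorem couplingCoeff_sq (c : ℝ) (u t : ℂ) :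
    couplingCoeff c (u ^ 2) t = u * selfEnergy c (u * t) := by
  rw [couplingCoeff, selfEnergy]
  ring

/-- From `u ^ 2 * t + |u| ^ 2 * t = 2 * Re u * (u * t)`. -/
theorem im_mul_pos_of_im_sq_mul_pos (hu : 0 < u.re) (ht : 0 < t.im) (hut : 0 < (u ^ 2 * t).im) :
    0 < (u * t).im := by
  have hsum : (u ^ 2 * t).im + Complex.normSq u * t.im = 2 * u.re * (u * t).im := by
    simp only [pow_two, Complex.mul_im, Complex.mul_re, Complex.normSq_apply]
    ring
  have hpos : 0 < 2 * u.re * (u * t).im := by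
    rw [← hsum]
    exact add_pos_of_pos_of_nonneg hut (mul_nonneg (Complex.normSq_nonneg u) ht.le)
  exact pos_of_mul_pos_right hpos (by positivity)

theorem smul_one_add_couplingCoeff_smul_conjDiagonal (l : Fin m → ℝ) (c : ℝ) (u t : ℂ) :
    u ^ 2 • (1 : Matrix (Fin m) (Fin m) ℂ) +
        couplingCoeff c (u ^ 2) t • conjDiagonal U (fun i => (l i : ℂ)) =
      conjDiagonal U fun i => u * (u + l i * selfEnergy c (u * t)) := by
  rw [← map_one (conjDiagonal U), ← map_smul, ← map_smul, ← map_add, couplingCoeff_sq]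
  congr 1
  ext i
  simp only [Pi.add_apply, Pi.smul_apply, Pi.one_apply, smul_eq_mul]
  ring

theorem mul_add_mul_selfEnergy_ne_zero (hl : ∀ i, 0 ≤ l i) (hc : 0 ≤ c) (hu : 0 < u.im)
    (hut : 0 < (u * t).im) (i : Fin m) : u * (u + l i * selfEnergy c (u * t)) ≠ 0 :=
  mul_ne_zero (ne_zero_of_im_pos hu)
    (add_mul_ne_zero_of_im (hl i) hu (selfEnergy_im_nonneg hc hut.le))

theorem canonicalT_conjDiagonal (hl : ∀ i, 0 ≤ l i) (hc : 0 ≤ c) (hu : 0 < u.im)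
    (hut : 0 < (u * t).im) :
    canonicalT c (conjDiagonal U fun i => (l i : ℂ)) (u ^ 2) t =
      conjDiagonal U fun i => u⁻¹ * dressedResolvent c (l i) u (u * t) := by
  rw [canonicalT, smul_one_add_couplingCoeff_smul_conjDiagonal,
    inv_conjDiagonal U (mul_add_mul_selfEnergy_ne_zero hl hc hu hut), ← map_neg]
  congr 1
  ext i
  rw [Pi.neg_apply, dressedResolvent, mul_inv, mul_neg]

theorem trace_canonicalT_conjDiagonal (hl : ∀ i, 0 ≤ l i) (hc : 0 ≤ c) (hu : 0 < u.im)
    (hut : 0 < (u * t).im) :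
    (1 / (m : ℂ)) * (conjDiagonal U (fun i => (l i : ℂ)) *
        canonicalT c (conjDiagonal U fun i => (l i : ℂ)) (u ^ 2) t).trace =
      u⁻¹ * resolventMap (fun i => l i / m) l c u (u * t) := by
  rw [canonicalT_conjDiagonal U hl hc hu hut, ← map_mul, trace_conjDiagonal, resolventMap,
    Finset.mul_sum, Finset.mul_sum]
  refine Finset.sum_congr rfl fun i _ => ?_
  rw [Pi.mul_apply]
  push_cast
  ring

theorem isCanonicalSolution_iff_trace {R : Matrix (Fin m) (Fin m) ℂ} {z : ℂ} :
    IsCanonicalSolution c R z t ↔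
      t = (1 / (m : ℂ)) * (R * canonicalT c R z t).trace ∧ 0 < t.im ∧ 0 < (z * t).im := by
  rw [IsCanonicalSolution, canonicalT, ← matrix_inv_neg, neg_add']

theorem isCanonicalSolution_sq_iff (hl : ∀ i, 0 ≤ l i) (hc : 0 ≤ c) (hu : 0 < u.im)
    (hu2 : 0 < (u ^ 2).im) :
    IsCanonicalSolution c (conjDiagonal U fun i => (l i : ℂ)) (u ^ 2) t ↔
      (0 < t.im ∧ 0 < (u ^ 2 * t).im) ∧ resolventMap (fun i => l i / m) l c u (u * t) = u * t := by
  rw [isCanonicalSolution_iff_trace, and_comm]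
  refine and_congr_right fun ⟨ht, hut⟩ => ?_
  rw [trace_canonicalT_conjDiagonal U hl hc hu
    (im_mul_pos_of_im_sq_mul_pos (re_pos_of_im_pos_of_im_sq_pos hu hu2) ht hut),
    eq_inv_mul_iff_mul_eq₀ (ne_zero_of_im_pos hu), eq_comm]

theorem im_mul_pos_of_isCanonicalSolution {R : Matrix (Fin m) (Fin m) ℂ} (hu : 0 < u.im)
    (hu2 : 0 < (u ^ 2).im) (ht : IsCanonicalSolution c R (u ^ 2) t) : 0 < (u * t).im :=
  im_mul_pos_of_im_sq_mul_pos (re_pos_of_im_pos_of_im_sq_pos hu hu2) ht.2.1 ht.2.2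

theorem isUnit_of_isCanonicalSolution {z : ℂ} (hl : ∀ i, 0 ≤ l i) (hc : 0 ≤ c) (hz : 0 < z.im)
    (ht : IsCanonicalSolution c (conjDiagonal U fun i => (l i : ℂ)) z t) :
    IsUnit (z • (1 : Matrix (Fin m) (Fin m) ℂ) +
      couplingCoeff c z t • conjDiagonal U fun i => (l i : ℂ)) := by
  obtain ⟨u, hu, rfl⟩ := exists_sq_eq_of_im_pos hz
  rw [smul_one_add_couplingCoeff_smul_conjDiagonal]
  exact isUnit_conjDiagonal U (mul_add_mul_selfEnergy_ne_zero hl hc hu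
    (im_mul_pos_of_isCanonicalSolution hu hz ht))

theorem one_sub_ne_zero_of_isCanonicalSolution {R : Matrix (Fin m) (Fin m) ℂ} {z : ℂ}
    (hz : 0 < z.im) (ht : IsCanonicalSolution c R z t) : 1 - z * (c : ℂ) ^ 2 * t ^ 2 ≠ 0 := by
  obtain ⟨u, hu, rfl⟩ := exists_sq_eq_of_im_pos hz
  convert one_sub_sq_mul_sq_ne_zero c (im_mul_pos_of_isCanonicalSolution hu hz ht) using 2
  ring

end CanonicalEquation

section CanonicalSolution

variable {m : ℕ} {U : Matrix.unitaryGroup (Fin m) ℂ} {l : Fin m → ℝ} {c : ℝ} {z t : ℂ}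
  {ν : Fin m → Measure ℝ}

theorem isCanonicalSolution_integral (hν : IsResolventFamily (fun i => l i / m) l c ν)
    (hl : ∀ i, 0 ≤ l i) (hτ : 0 < ∑ i, l i / m) (hc : 0 < c) (hz : 0 < z.im) :
    IsCanonicalSolution c (conjDiagonal U fun i => (l i : ℂ)) z
      (∫ x : ℝ, ((x : ℂ) - z)⁻¹ ∂weightedMeasure (fun i => l i / m) ν) := by
  have ha : ∀ i, 0 ≤ l i / m := fun i => div_nonneg (hl i) m.cast_nonneg
  have har : 0 < ∑ i, l i / m * l i := by
    obtain ⟨i, -, hi⟩ := Finset.exists_lt_of_sum_lt (by simpa using hτ : ∑ _i : Fin m, (0:ℝ) < _)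
    refine Finset.sum_pos' (fun j _ => mul_nonneg (ha j) (hl j)) ⟨i, Finset.mem_univ i, ?_⟩
    exact mul_pos hi ((hl i).lt_of_ne fun h => by simp [← h] at hi)
  obtain ⟨u, hu, rfl⟩ := exists_sq_eq_of_im_pos hz
  obtain ⟨h, hh, hfix, -⟩ := exists_tendsto_iterate_resolventMap ha hτ hl hc.le hu
  rw [isCanonicalSolution_sq_iff U hl hc.le hu hz, ← hν.eq_mul_integral ha hu hz hh hfix]
  exact ⟨⟨hν.im_integral_pos ha hτ hz, hν.im_mul_integral_pos ha hτ har hc hz⟩, hfix⟩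

theorem eq_integral_of_isCanonicalSolution (hν : IsResolventFamily (fun i => l i / m) l c ν)
    (hl : ∀ i, 0 ≤ l i) (hc : 0 ≤ c) (hz : 0 < z.im)
    (ht : IsCanonicalSolution c (conjDiagonal U fun i => (l i : ℂ)) z t) :
    t = ∫ x : ℝ, ((x : ℂ) - z)⁻¹ ∂weightedMeasure (fun i => l i / m) ν := by
  obtain ⟨u, hu, rfl⟩ := exists_sq_eq_of_im_pos hz
  exact mul_left_cancel₀ (ne_zero_of_im_pos hu) (hν.eq_mul_integral
    (fun i => div_nonneg (hl i) m.cast_nonneg) hu hz (im_mul_pos_of_isCanonicalSolution hu hz ht)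
    ((isCanonicalSolution_sq_iff U hl hc hu hz).1 ht).2)

theorem canonicalT_eq_conjDiagonal_integral (hν : IsResolventFamily (fun i => l i / m) l c ν)
    (hl : ∀ i, 0 ≤ l i) (hc : 0 ≤ c) (hz : 0 < z.im)
    (ht : IsCanonicalSolution c (conjDiagonal U fun i => (l i : ℂ)) z t) :
    canonicalT c (conjDiagonal U fun i => (l i : ℂ)) z t =
      conjDiagonal U fun i => ∫ x : ℝ, ((x : ℂ) - z)⁻¹ ∂ν i := by
  obtain ⟨u, hu, rfl⟩ := exists_sq_eq_of_im_pos hz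
  have hut := im_mul_pos_of_isCanonicalSolution hu hz ht
  rw [canonicalT_conjDiagonal U hl hc hu hut]
  congr 1
  ext i
  rw [hν.dressedResolvent_eq i u _ hu hz hut ((isCanonicalSolution_sq_iff U hl hc hu hz).1 ht).2,
    inv_mul_cancel_left₀ (ne_zero_of_im_pos hu)]

end CanonicalSolution

section Measures

variable {m : ℕ} {U : Matrix.unitaryGroup (Fin m) ℂ} {l : Fin m → ℝ} {c : ℝ}
  {ν : Fin m → Measure ℝ}

theorem one_div_mul_trace_conjDiagonal (d : Fin m → ℝ) :
    (1 / (m : ℂ)) * (conjDiagonal U fun i => (d i : ℂ)).trace = ((∑ i, d i / m : ℝ) : ℂ) := by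
  rw [trace_conjDiagonal, Finset.mul_sum]
  push_cast
  exact Finset.sum_congr rfl fun i _ => by ring

theorem IsResolventFamily.isStieltjesTransform
    (hν : IsResolventFamily (fun i => l i / m) l c ν) (hl : ∀ i, 0 ≤ l i) (hc : 0 ≤ c)
    {t : ℂ → ℂ} (ht : ∀ z : ℂ, 0 < z.im →
      IsCanonicalSolution c (conjDiagonal U fun i => (l i : ℂ)) z (t z)) :
    IsStieltjesTransform (Set.Ici 0) (weightedMeasure (fun i => l i / m) ν) t := by
  have := hν.isProbabilityMeasure
  exact ⟨inferInstance, mem_ae_iff.1 (ae_weightedMeasure hν.ae_nonneg),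
    fun z hz => eq_integral_of_isCanonicalSolution hν hl hc hz (ht z hz)⟩

theorem IsResolventFamily.exists_matrixMeasure
    (hν : IsResolventFamily (fun i => l i / m) l c ν) (hl : ∀ i, 0 ≤ l i) (hc : 0 ≤ c)
    {t : ℂ → ℂ} (ht : ∀ z : ℂ, 0 < z.im →
      IsCanonicalSolution c (conjDiagonal U fun i => (l i : ℂ)) z (t z)) :
    ∃ νT : VectorMeasure ℝ (Matrix (Fin m) (Fin m) ℂ),
      IsMatrixStieltjesTransform (Set.Ici 0) νT
        (fun z => canonicalT c (conjDiagonal U fun i => (l i : ℂ)) z (t z)) ∧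
      νT (Set.Ici 0) = 1 ∧
      ∀ S : Set ℝ, MeasurableSet S → (((weightedMeasure (fun i => l i / m) ν).real S : ℝ) : ℂ) =
        (1 / (m : ℂ)) * (conjDiagonal U (fun i => (l i : ℂ)) * νT S).trace := by
  have := hν.isProbabilityMeasure
  refine ⟨conjDiagonalMeasure U ν, isMatrixStieltjesTransform_conjDiagonalMeasure U
    measurableSet_Ici (fun i => mem_ae_iff.1 (hν.ae_nonneg i))
    fun z hz => canonicalT_eq_conjDiagonal_integral hν hl hc hz (ht z hz), ?_, fun S hS => ?_⟩
  · rw [conjDiagonalMeasure_apply U measurableSet_Ici]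
    simp only [hν.real_Ici_zero, Complex.ofReal_one]
    exact map_one _
  · have hmul : conjDiagonal U (fun i => (l i : ℂ)) * conjDiagonalMeasure U ν S =
        conjDiagonal U fun i => ((l i * (ν i).real S : ℝ) : ℂ) := by
      rw [conjDiagonalMeasure_apply U hS, ← map_mul]
      congr 1
      ext i
      exact (Complex.ofReal_mul _ _).symm
    rw [hmul, one_div_mul_trace_conjDiagonal,
      weightedMeasure_real_apply fun i => div_nonneg (hl i) m.cast_nonneg]
    congr! 2 with i
    ring

theorem IsResolventFamily.real_Ici_zero_eq_trace
    (hν : IsResolventFamily (fun i => l i / m) l c ν) (hl : ∀ i, 0 ≤ l i) :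
    (((weightedMeasure (fun i => l i / m) ν).real (Set.Ici 0) : ℝ) : ℂ) =
      (1 / (m : ℂ)) * (conjDiagonal U fun i => (l i : ℂ)).trace := by
  have := hν.isProbabilityMeasure
  rw [weightedMeasure_real_apply fun i => div_nonneg (hl i) m.cast_nonneg,
    one_div_mul_trace_conjDiagonal]
  simp only [hν.real_Ici_zero, mul_one]

theorem IsResolventFamily.setIntegral_id_eq_trace
    (hν : IsResolventFamily (fun i => l i / m) l c ν) (hl : ∀ i, 0 ≤ l i) :
    ((∫ x in Set.Ici (0 : ℝ), x ∂weightedMeasure (fun i => l i / m) ν : ℝ) : ℂ) =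
      (c : ℂ) * ((1 / (m : ℂ)) * (conjDiagonal U fun i => (l i : ℂ)).trace) *
        ((1 / (m : ℂ)) * ((conjDiagonal U fun i => (l i : ℂ)) ^ 2).trace) := by
  have hsq : (conjDiagonal U fun i => (l i : ℂ)) ^ 2 =
      conjDiagonal U fun i => ((l i ^ 2 : ℝ) : ℂ) := by
    rw [← map_pow]
    congr 1
    ext i
    exact (Complex.ofReal_pow _ _).symm
  have hmem : ∀ᵐ x ∂weightedMeasure (fun i => l i / m) ν, x ∈ Set.Ici (0 : ℝ) :=
    ae_weightedMeasure hν.ae_nonneg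
  rw [Measure.restrict_eq_self_of_ae_mem hmem,
    hν.integral_weightedMeasure_id fun i => div_nonneg (hl i) m.cast_nonneg, hsq,
    one_div_mul_trace_conjDiagonal, one_div_mul_trace_conjDiagonal]
  push_cast
  congr! 2 with i
  ring

end Measures

section LowerBound

variable {m : ℕ} {U : Matrix.unitaryGroup (Fin m) ℂ} {l : Fin m → ℝ} {c b K : ℝ} {z t : ℂ}
  {ν : Fin m → Measure ℝ}

theorem im_mul_norm_le_of_isCanonicalSolution (hl : ∀ i, 0 ≤ l i) (hc : 0 ≤ c) (hz : 0 < z.im)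
    (ht : IsCanonicalSolution c (conjDiagonal U fun i => (l i : ℂ)) z t) :
    z.im * ‖t‖ ≤ 2 * (∑ i, l i / m) * ‖1 - z * ((c : ℂ) * t) ^ 2‖ := by
  have ha : ∀ i, 0 ≤ l i / m := fun i => div_nonneg (hl i) m.cast_nonneg
  obtain ⟨u, hu, rfl⟩ := exists_sq_eq_of_im_pos hz
  have hut := im_mul_pos_of_isCanonicalSolution hu hz ht
  have hsq := im_mul_norm_resolventMap_sq_le ha hl hc hu.le hut.le
  rw [((isCanonicalSolution_sq_iff U hl hc hu hz).1 ht).2] at hsq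
  have hut_le := im_mul_norm_le_of_im_mul_norm_sq_le (Finset.sum_nonneg fun i _ => ha i) c hut hsq
  calc (u ^ 2).im * ‖t‖ = 2 * (u.im * (u.re * ‖t‖)) := by rw [pow_two, Complex.mul_im]; ring
    _ ≤ 2 * (u.im * ‖u * t‖) := by
      rw [norm_mul]
      have := Complex.re_le_norm u
      gcongr
    _ ≤ 2 * ((∑ i, l i / m) * ‖1 - (c : ℂ) ^ 2 * (u * t) ^ 2‖) := by gcongr
    _ = 2 * (∑ i, l i / m) * ‖1 - u ^ 2 * ((c : ℂ) * t) ^ 2‖ := by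
      rw [mul_assoc, show (c : ℂ) ^ 2 * (u * t) ^ 2 = u ^ 2 * ((c : ℂ) * t) ^ 2 by ring]

theorem sum_div_mul_self_le (hl : ∀ i, 0 ≤ l i) (hlb : ∀ i, l i ≤ b) :
    ∑ i, l i / m * l i ≤ b ^ 2 := by
  rcases m.eq_zero_or_pos with rfl | hm
  · simpa using sq_nonneg b
  calc ∑ i, l i / m * l i ≤ ∑ _i : Fin m, b ^ 2 / m := Finset.sum_le_sum fun i _ => by
        rw [div_mul_eq_mul_div, ← pow_two]
        have := hl i
        have := hlb i
        gcongr
    _ = b ^ 2 := by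
      rw [Finset.sum_const, Finset.card_univ, Fintype.card_fin, nsmul_eq_mul]
      field_simp

theorem im_sq_le_of_isCanonicalSolution (hν : IsResolventFamily (fun i => l i / m) l c ν)
    (hl : ∀ i, 0 ≤ l i) (hτ : 0 < ∑ i, l i / m) (hlb : ∀ i, l i ≤ b) (hc : 0 ≤ c) (hK : 0 < K)
    (hKb : 2 * (c * b ^ 2) ≤ K) (hz : 0 < z.im)
    (ht : IsCanonicalSolution c (conjDiagonal U fun i => (l i : ℂ)) z t) :
    z.im ^ 2 ≤ 8 * (K ^ 2 + ‖z‖ ^ 2) * ‖1 - z * ((c : ℂ) * t) ^ 2‖ := by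
  have ha : ∀ i, 0 ≤ l i / m := fun i => div_nonneg (hl i) m.cast_nonneg
  have hlower : z.im / (4 * (K ^ 2 + ‖z‖ ^ 2)) * ∑ i, l i / m ≤ ‖t‖ := by
    refine (hν.sum_mul_div_le_im_integral ha hK ?_ hz).trans ?_
    · exact le_trans (by gcongr; exact sum_div_mul_self_le hl hlb) hKb
    · rw [← eq_integral_of_isCanonicalSolution hν hl hc hz ht]
      exact Complex.im_le_norm t
  have hcancel : z.im ^ 2 / (4 * (K ^ 2 + ‖z‖ ^ 2)) ≤ 2 * ‖1 - z * ((c : ℂ) * t) ^ 2‖ := by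
    refine le_of_mul_le_mul_left ?_ hτ
    calc (∑ i, l i / m) * (z.im ^ 2 / (4 * (K ^ 2 + ‖z‖ ^ 2)))
        = z.im * (z.im / (4 * (K ^ 2 + ‖z‖ ^ 2)) * ∑ i, l i / m) := by ring
      _ ≤ z.im * ‖t‖ := mul_le_mul_of_nonneg_left hlower hz.le
      _ ≤ 2 * (∑ i, l i / m) * ‖1 - z * ((c : ℂ) * t) ^ 2‖ :=
        im_mul_norm_le_of_isCanonicalSolution hl hc hz ht
      _ = (∑ i, l i / m) * (2 * ‖1 - z * ((c : ℂ) * t) ^ 2‖) := by ring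
  rw [div_le_iff₀ (by positivity)] at hcancel
  linarith

theorem one_div_norm_le_of_isCanonicalSolution (hν : IsResolventFamily (fun i => l i / m) l c ν)
    (hl : ∀ i, 0 ≤ l i) (hτ : 0 < ∑ i, l i / m) (hlb : ∀ i, l i ≤ b) (hc : 0 ≤ c) (hK : 1 ≤ K)
    (hKb : 2 * (c * b ^ 2) ≤ K) (hz : 0 < z.im)
    (ht : IsCanonicalSolution c (conjDiagonal U fun i => (l i : ℂ)) z t) :
    1 / ‖1 - z * ((c : ℂ) * t) ^ 2‖ ≤ 8 * (K ^ 2 + ‖z‖ ^ 2) ^ 2 / z.im ^ 3 := by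
  have hsq := im_sq_le_of_isCanonicalSolution hν hl hτ hlb hc (zero_lt_one.trans_le hK) hKb hz ht
  have hpos : 0 < ‖1 - z * ((c : ℂ) * t) ^ 2‖ :=
    pos_of_mul_pos_right ((pow_pos hz 2).trans_le hsq) (by positivity)
  have him : z.im ≤ K ^ 2 + ‖z‖ ^ 2 := by
    nlinarith [Complex.im_le_norm z, sq_nonneg (‖z‖ - 1)]
  rw [div_le_div_iff₀ hpos (by positivity)]
  calc 1 * z.im ^ 3 = z.im ^ 2 * z.im := by ring
    _ ≤ 8 * (K ^ 2 + ‖z‖ ^ 2) * ‖1 - z * ((c : ℂ) * t) ^ 2‖ * (K ^ 2 + ‖z‖ ^ 2) := by gcongr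
    _ = 8 * (K ^ 2 + ‖z‖ ^ 2) ^ 2 * ‖1 - z * ((c : ℂ) * t) ^ 2‖ := by ring

end LowerBound

section OneMatrix

variable {m : ℕ} {R : Matrix (Fin m) (Fin m) ℂ} {b c K : ℝ} {z : ℂ}

theorem exists_isResolventFamily_of_posSemidef (hR : R.PosSemidef) (hR0 : R ≠ 0) (hc : 0 ≤ c) :
    ∃ (U : Matrix.unitaryGroup (Fin m) ℂ) (l : Fin m → ℝ) (ν : Fin m → Measure ℝ),
      R = (conjDiagonal U fun i => (l i : ℂ)) ∧ (∀ i, 0 ≤ l i) ∧ 0 < ∑ i, l i / m ∧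
      (∀ b : ℝ, ((b : ℂ) • (1 : Matrix (Fin m) (Fin m) ℂ) - R).PosSemidef → ∀ i, l i ≤ b) ∧
      IsResolventFamily (fun i => l i / m) l c ν := by
  have hl := hR.eigenvalues_nonneg
  have ha : ∀ i, 0 ≤ hR.1.eigenvalues i / m := fun i => div_nonneg (hl i) m.cast_nonneg
  have hτ : 0 < ∑ i, hR.1.eigenvalues i / m := by
    refine (Finset.sum_nonneg fun i _ => ha i).lt_of_ne' fun h => hR0 ?_
    rw [Finset.sum_eq_zero_iff_of_nonneg fun i _ => ha i] at h
    refine hR.1.eigenvalues_eq_zero_iff.1 (funext fun i => ?_)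
    exact (div_eq_zero_iff.1 (h i (Finset.mem_univ i))).resolve_right
      (Nat.cast_ne_zero.2 i.pos.ne')
  obtain ⟨ν, hν⟩ := exists_isResolventFamily ha hτ hl hc
  exact ⟨_, _, ν, eq_conjDiagonal_eigenvalues hR.1, hl, hτ, fun _ hb => eigenvalues_le hR.1 hb, hν⟩

theorem existsUnique_isCanonicalSolution (hR : R.PosSemidef) (hR0 : R ≠ 0) (hc : 0 < c)
    (hz : 0 < z.im) : ∃! t, IsCanonicalSolution c R z t := by
  obtain ⟨U, l, ν, rfl, hl, hτ, -, hν⟩ := exists_isResolventFamily_of_posSemidef hR hR0 hc.le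
  exact ⟨_, isCanonicalSolution_integral hν hl hτ hc hz,
    fun t ht => eq_integral_of_isCanonicalSolution hν hl hc.le hz ht⟩

theorem isUnit_of_isCanonicalSolution_of_posSemidef (hR : R.PosSemidef) (hc : 0 ≤ c)
    (hz : 0 < z.im) {t : ℂ} (ht : IsCanonicalSolution c R z t) :
    IsUnit (z • (1 : Matrix (Fin m) (Fin m) ℂ) + couplingCoeff c z t • R) := by
  rw [eq_conjDiagonal_eigenvalues hR.1] at ht ⊢
  exact isUnit_of_isCanonicalSolution _ hR.eigenvalues_nonneg hc hz ht

theorem exists_measure_of_isCanonicalSolution (hR : R.PosSemidef) (hR0 : R ≠ 0) (hc : 0 ≤ c)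
    {t : ℂ → ℂ} (ht : ∀ z : ℂ, 0 < z.im → IsCanonicalSolution c R z (t z)) :
    ∃ (μ : Measure ℝ) (ν : VectorMeasure ℝ (Matrix (Fin m) (Fin m) ℂ)),
      IsStieltjesTransform (Set.Ici 0) μ t ∧
      ((μ.real (Set.Ici 0) : ℝ) : ℂ) = (1 / (m : ℂ)) * R.trace ∧
      Integrable (fun x : ℝ => x) μ ∧
      ((∫ x in Set.Ici (0 : ℝ), x ∂μ : ℝ) : ℂ) =
        (c : ℂ) * ((1 / (m : ℂ)) * R.trace) * ((1 / (m : ℂ)) * (R ^ 2).trace) ∧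
      IsMatrixStieltjesTransform (Set.Ici 0) ν (fun z => canonicalT c R z (t z)) ∧
      ν (Set.Ici 0) = 1 ∧
      ∀ S : Set ℝ, MeasurableSet S →
        ((μ.real S : ℝ) : ℂ) = (1 / (m : ℂ)) * (R * ν S).trace := by
  obtain ⟨U, l, ν, rfl, hl, -, -, hν⟩ := exists_isResolventFamily_of_posSemidef hR hR0 hc
  obtain ⟨νT, hνT⟩ := hν.exists_matrixMeasure hl hc ht
  exact ⟨_, νT, hν.isStieltjesTransform hl hc ht, hν.real_Ici_zero_eq_trace hl,
    integrable_weightedMeasure hν.integrable_id, hν.setIntegral_id_eq_trace hl, hνT⟩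

theorem one_div_norm_le_of_isCanonicalSolution_of_posSemidef (hR : R.PosSemidef) (hR0 : R ≠ 0)
    (hRb : ((b : ℂ) • (1 : Matrix (Fin m) (Fin m) ℂ) - R).PosSemidef) (hc : 0 ≤ c) (hK : 1 ≤ K)
    (hKb : 2 * (c * b ^ 2) ≤ K) (hz : 0 < z.im) {t : ℂ} (ht : IsCanonicalSolution c R z t) :
    1 / ‖1 - z * ((c : ℂ) * t) ^ 2‖ ≤ 8 * (K ^ 2 + ‖z‖ ^ 2) ^ 2 / z.im ^ 3 := by
  obtain ⟨U, l, ν, rfl, hl, hτ, hlb, hν⟩ := exists_isResolventFamily_of_posSemidef hR hR0 hc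
  exact one_div_norm_le_of_isCanonicalSolution hν hl hτ (hlb b hRb) hc hK hKb hz ht

end OneMatrix

theorem dimRatio_pos {L : ℕ} {M : ℕ → ℕ} {cstar : ℝ} (hcstar : 0 < cstar)
    (hc : Tendsto (dimRatio L M) atTop (𝓝 cstar)) {N : ℕ} (hN : 1 ≤ N) (hM : 1 ≤ M N) :
    0 < dimRatio L M N := by
  have hL : L ≠ 0 := by
    rintro rfl
    have hzero : dimRatio 0 M = fun _ => 0 := funext fun N => by
      rw [dimRatio, Nat.cast_zero, mul_zero, zero_div]
    rw [hzero] at hc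
    exact hcstar.ne (tendsto_nhds_unique tendsto_const_nhds hc)
  have : 0 < L := Nat.pos_of_ne_zero hL
  rw [dimRatio]
  positivity

section

variable {m : ℕ} {R : Matrix (Fin m) (Fin m) ℂ} {a : ℝ}

theorem posSemidef_of_posSemidef_sub_smul_one (ha : 0 ≤ a)
    (hR : (R - (a : ℂ) • (1 : Matrix (Fin m) (Fin m) ℂ)).PosSemidef) : R.PosSemidef := by
  simpa only [sub_add_cancel] using
    hR.add (Matrix.PosSemidef.one.smul (Complex.zero_le_real.2 ha))

theorem ne_zero_of_posSemidef_sub_smul_one (ha : 0 < a) (hm : 1 ≤ m)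
    (hR : (R - (a : ℂ) • (1 : Matrix (Fin m) (Fin m) ℂ)).PosSemidef) : R ≠ 0 := by
  rintro rfl
  have hdiag := hR.diag_nonneg (i := (⟨0, hm⟩ : Fin m))
  rw [Matrix.sub_apply, Matrix.smul_apply, Matrix.one_apply_eq, Matrix.zero_apply, zero_sub,
    smul_eq_mul, mul_one, neg_nonneg, ← Complex.ofReal_zero, Complex.real_le_real] at hdiag
  exact hdiag.not_gt ha

end

theorem mainTheorem5_general {ι : Type*} {s : Set ι} {m : ι → ℕ} {c : ι → ℝ}
    (hc : ∀ i ∈ s, 0 < c i) (hcb : BddAbove (c '' s))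
    {R : (i : ι) → Matrix (Fin (m i)) (Fin (m i)) ℂ} (hR : ∀ i ∈ s, (R i).PosSemidef)
    (hR0 : ∀ i ∈ s, R i ≠ 0) {b : ℝ}
    (hRb : ∀ i ∈ s, ((b : ℂ) • (1 : Matrix (Fin (m i)) (Fin (m i)) ℂ) - R i).PosSemidef) :
    (∀ i ∈ s, ∀ z : ℂ, 0 < z.im → ∃! t : ℂ, IsCanonicalSolution (c i) (R i) z t) ∧
    ∀ t : ι → ℂ → ℂ,
      (∀ i ∈ s, ∀ z : ℂ, 0 < z.im → IsCanonicalSolution (c i) (R i) z (t i z)) →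
      (∀ i ∈ s, ∀ z : ℂ, 0 < z.im →
        1 - z * (c i : ℂ) ^ 2 * t i z ^ 2 ≠ 0 ∧
        IsUnit (z • (1 : Matrix (Fin (m i)) (Fin (m i)) ℂ) +
          couplingCoeff (c i) z (t i z) • R i)) ∧
      (∀ i ∈ s, ∃ (μ : Measure ℝ) (ν : VectorMeasure ℝ (Matrix (Fin (m i)) (Fin (m i)) ℂ)),
        IsStieltjesTransform (Set.Ici 0) μ (t i) ∧
        ((μ.real (Set.Ici 0) : ℝ) : ℂ) = (1 / (m i : ℂ)) * (R i).trace ∧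
        Integrable (fun x : ℝ => x) μ ∧
        ((∫ x in Set.Ici (0 : ℝ), x ∂μ : ℝ) : ℂ) =
          (c i : ℂ) * ((1 / (m i : ℂ)) * (R i).trace) * ((1 / (m i : ℂ)) * (R i ^ 2).trace) ∧
        IsMatrixStieltjesTransform (Set.Ici 0) ν (fun z => canonicalT (c i) (R i) z (t i z)) ∧
        ν (Set.Ici 0) = 1 ∧
        ∀ S : Set ℝ, MeasurableSet S →
          ((μ.real S : ℝ) : ℂ) = (1 / (m i : ℂ)) * (R i * ν S).trace) ∧
      (∃ β κ : ℝ, 0 < β ∧ 0 < κ ∧ ∀ i ∈ s, ∀ z : ℂ, 0 < z.im →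
        1 / ‖1 - z * ((c i : ℂ) * t i z) ^ 2‖ ≤ κ * (β ^ 2 + ‖z‖ ^ 2) ^ 2 / z.im ^ 3) := by
  obtain ⟨C, hC⟩ := hcb
  have hK : ∀ i ∈ s, 2 * (c i * b ^ 2) ≤ max 1 (2 * (C * b ^ 2)) := fun i hi => by
    have := hC (Set.mem_image_of_mem c hi)
    exact le_max_of_le_right (by gcongr)
  refine ⟨fun i hi z hz => existsUnique_isCanonicalSolution (hR i hi) (hR0 i hi) (hc i hi) hz,
    fun t ht => ⟨fun i hi z hz => ⟨?_, ?_⟩, fun i hi => ?_, ?_⟩⟩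
  · exact one_sub_ne_zero_of_isCanonicalSolution hz (ht i hi z hz)
  · exact isUnit_of_isCanonicalSolution_of_posSemidef (hR i hi) (hc i hi).le hz (ht i hi z hz)
  · exact exists_measure_of_isCanonicalSolution (hR i hi) (hR0 i hi) (hc i hi).le (ht i hi)
  · exact ⟨max 1 (2 * (C * b ^ 2)), 8, by positivity, by norm_num, fun i hi z hz =>
      one_div_norm_le_of_isCanonicalSolution_of_posSemidef (hR i hi) (hR0 i hi) (hRb i hi)
        (hc i hi).le (le_max_left _ _) (hK i hi) hz (ht i hi z hz)⟩

theorem mainTheorem5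
    (L : ℕ) (M : ℕ → ℕ) (hM : ∀ N : ℕ, 1 ≤ N → 1 ≤ M N)
    (cstar : ℝ) (hcstar : 0 < cstar)
    (hc : Tendsto (dimRatio L M) atTop (𝓝 cstar))
    (a b : ℝ) (ha : 0 < a) (hb : 0 < b)
    (R : (N : ℕ) → Matrix (Fin (M N)) (Fin (M N)) ℂ)
    (hRa : ∀ N : ℕ, 1 ≤ N →
      (R N - (a : ℂ) • (1 : Matrix (Fin (M N)) (Fin (M N)) ℂ)).PosSemidef)
    (hRb : ∀ N : ℕ, 1 ≤ N →
      ((b : ℂ) • (1 : Matrix (Fin (M N)) (Fin (M N)) ℂ) - R N).PosDef) :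
    (∀ N : ℕ, 1 ≤ N → ∀ z : ℂ, 0 < z.im →
      ∃! s : ℂ, IsCanonicalSolution (dimRatio L M N) (R N) z s) ∧
    ∀ t : ℕ → ℂ → ℂ,
      (∀ N : ℕ, 1 ≤ N → ∀ z : ℂ, 0 < z.im →
        IsCanonicalSolution (dimRatio L M N) (R N) z (t N z)) →
      -- neither the quotient nor the inverse in the equation is degenerate
      (∀ N : ℕ, 1 ≤ N → ∀ z : ℂ, 0 < z.im →
        1 - z * (dimRatio L M N : ℂ) ^ 2 * t N z ^ 2 ≠ 0 ∧
        IsUnit (z • (1 : Matrix (Fin (M N)) (Fin (M N)) ℂ) +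
          couplingCoeff (dimRatio L M N) z (t N z) • R N)) ∧
      -- the measures associated with `t_N` and `T_N`
      (∀ N : ℕ, 1 ≤ N →
        ∃ (μ : Measure ℝ) (ν : VectorMeasure ℝ (Matrix (Fin (M N)) (Fin (M N)) ℂ)),
          IsStieltjesTransform (Set.Ici 0) μ (t N) ∧
          ((μ.real (Set.Ici 0) : ℝ) : ℂ) = (1 / (M N : ℂ)) * (R N).trace ∧
          Integrable (fun x : ℝ => x) μ ∧
          ((∫ x in Set.Ici (0 : ℝ), x ∂μ : ℝ) : ℂ) =
            (dimRatio L M N : ℂ) * ((1 / (M N : ℂ)) * (R N).trace) *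
              ((1 / (M N : ℂ)) * (R N ^ 2).trace) ∧
          IsMatrixStieltjesTransform (Set.Ici 0) ν
            (fun z => canonicalT (dimRatio L M N) (R N) z (t N z)) ∧
          ν (Set.Ici 0) = 1 ∧
          ∀ S : Set ℝ, MeasurableSet S →
            ((μ.real S : ℝ) : ℂ) = (1 / (M N : ℂ)) * (R N * ν S).trace) ∧
      -- the uniform lower bound on `|1 - z (c_N t_N(z))²|`
      (∃ β κ : ℝ, 0 < β ∧ 0 < κ ∧ ∀ N : ℕ, 1 ≤ N → ∀ z : ℂ, 0 < z.im →
        1 / ‖1 - z * ((dimRatio L M N : ℂ) * t N z) ^ 2‖ ≤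
          κ * (β ^ 2 + ‖z‖ ^ 2) ^ 2 / z.im ^ 3) :=
  mainTheorem5_general (s := Set.Ici 1) (fun N hN => dimRatio_pos hcstar hc hN (hM N hN))
    (hc.bddAbove_range.mono (Set.image_subset_range _ _))
    (fun N hN => posSemidef_of_posSemidef_sub_smul_one ha.le (hRa N hN))
    (fun N hN => ne_zero_of_posSemidef_sub_smul_one ha (hM N hN) (hRa N hN))
    fun N hN => (hRb N hN).posSemidef
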